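/- **Setting.** Let $T>0$, $n,m\ge 0$ integers, and let $A:[0,T]\times\mathbb R^n\to\mathbb R^n$, $B:[0,T]\times\mathbb R^n\to\mathbb R^{n\times m}$, $Q:[0,T]\times\mathbb R^n\to\mathbb R$, $S:[0,T]\times\mathbb R^n\to\mathbb R^m$, $R:[0,T]\times\mathbb R^n\to\mathbb S^m$ (symmetric matrices), $G:\mathbb R^n\to\mathbb R$. Here $|\cdot|$ is the Euclidean norm of vectors and the operator norm of matrices, $M\ge N$ between symmetric matrices (or self-adjoint operators) means that $M-N$ is positive semidefinite, and $\mathbb S^n_+$ is the set of symmetric positive semidefinite matrices. Assume: (H1) $A,B$ are continuous and there are constants $L_A,L_B,\tilde L_B>0$ such that for all $t\in[0,T]$, $x,\bar x\in\mathbb R^n$, $u\in\mathbb R^m$: $|A(t,x)-A(t,\bar x)|\le L_A|x-\bar x|$, $|B(t,x)-B(t,\bar x)|\le\tilde L_B|x-\bar x|$, $\langle[B(t,x)-B(t,\bar x)]^T(x-\bar x),u\rangle\le L_B|x-\bar x|^2$. (H2) $Q,S,R,G$ are continuous and there are constants $L,Q_0,G_0,S_0>0$, $\varepsilon_0\in(0,1)$,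 $\rho_0>0$ and a continuous $\rho:\mathbb R^n\to[\rho_0,\infty)$ such that for all $(t,x)\in[0,T]\times\mathbb R^n$: $R(t,x)\ge\rho(x)I$; $(1-\varepsilon_0)Q(t,x)-\frac12S(t,x)^TR(t,x)^{-1}S(t,x)\ge-L$; $G(x)\ge-L$; $Q(t,x)\le Q_0(1+|x|^2)$; $G(x)\le G_0(1+|x|^2)$; $|S(t,x)|\le S_0(1+|x|)$; $|A(t,x)+B(t,x)R(t,x)^{-1}S(t,x)|\le L(1+|x|)$; $|B(t,x)R(t,x)^{-1}B(t,x)^T|\le L$. (H3) $A,B,Q,S,R,G$ are twice continuously differentiable. For $(t,x)\in[0,T]\times\mathbb R^n$ and $u\in\mathcal U[t,T]=L^2(t,T;\mathbb R^m)$ let $$J(t,x;u)=\int_t^T\Big[Q(s,X(s))+\langle S(s,X(s)),u(s)\rangle+\tfrac12\langle R(s,X(s))u(s),u(s)\rangle\Big]ds+G(X(T)),$$ where $X$ is the solution of $\dot X=A(s,X)+B(s,X)u$ on $[t,T]$, $X(t)=x$. Let $D_uJ(t,x;u)\in L^2(t,T;\mathbb R^m)$ be the gradient of $J(t,x;\cdot)$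 at $u$, and $D_{uu}J(t,x;u)$, a bounded operator on $L^2(t,T;\mathbb R^m)$, the derivative of $D_uJ(t,x;\cdot)$ at $u$ (both in the sense of Fréchet). Fix $(t,x)\in[0,T]\times\mathbb R^n$ and $u\in\mathcal U[t,T]$, and let $X$ be as above. Let $Y$ solve, on $[t,T]$, $$\dot Y=-\mathbf A(s)^TY-Q_x(s,X)^T-S_x(s,X)^Tu-\tfrac12\sum_{j,k=1}^mu^ju^kR^{jk}_x(s,X)^T,\qquad Y(T)=G_x(X(T))^T.$$ With $B^j$ and $R^j$ the $j$-th columns of $B$ and $R$, and $\tilde B^i$ the $i$-th column of $B^T$, all coefficients being evaluated at $(s,X(s))$ and $u,Y$ at $s$, put $$\begin{aligned}\mathbf A(s)&=A_x+\sum_ju^jB^j_x,\\ \mathbf A_1(s)&=\sum_iY^iA^i_{xx}+Q_{xx}+\tfrac12\sum_{j,k}u^ju^kR^{jk}_{xx}+\sum_ju^j\Big[\sum_iY^iB^{ij}_{xx}+S^j_{xx}\Big],\\ \mathbf C(s)&=\sum_ju^jR^j_x+S_x+\sum_iY^i\tilde B^i_x.\end{aligned}$$ Let $\Phi=\Phi_{\mathbf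 A}$ be the fundamental matrix of $\mathbf A$: $\frac{d}{ds}\Phi(s,\tau)=\mathbf A(s)\Phi(s,\tau)$ for $s\in[\tau,T]$, $\Phi(\tau,\tau)=I$, for $\tau\in[t,T]$. (All differential equations are understood in integrated form, with continuous solutions.) **Proposition 5.2.** (a) $J(t,x;\cdot)$ is Fréchet differentiable on $L^2(t,T;\mathbb R^m)$ and $D_uJ(t,x;\cdot)$ is Fréchet differentiable at $u$. For every $v\in L^2(t,T;\mathbb R^m)$, with $X_1(s)=\int_t^s\Phi(s,r)B(r,X(r))v(r)\,dr$, all integrals below converge and $$\begin{aligned}\int_t^T\langle[D_{uu}J(t,x;u)v](s),v(s)\rangle ds={}&\int_t^T\langle R(s,X(s))v(s),v(s)\rangle ds+\langle G_{xx}(X(T))X_1(T),X_1(T)\rangle\\&+\int_t^T\langle\mathbf A_1(s)X_1(s),X_1(s)\rangle ds+2\int_t^T\langle\mathbf C(s)X_1(s),v(s)\rangle ds.\end{aligned}$$ (b) Suppose that $\bar G\in\mathbb S^n_+$, $\bar Q:[0,T]\to\mathbb S^n_+$, $\alpha\in(0,1)$ and $\delta>0$ satisfy $G_{xx}(X(T))+\bar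 G\ge0$, $$\mathbf A_1(s)+\bar Q(s)-\alpha^{-1}\mathbf C(s)^TR(s,X(s))^{-1}\mathbf C(s)\ge0\quad\text{for a.e. }s\in[t,T],$$ and $$(1-\alpha)R(s,X(s))-[\hat G(t)+\hat Q(s,t)]I\ge\delta I\quad\text{for all }s\in[t,T],$$ where $$\begin{aligned}\hat G(t)&=\Big[\int_t^T\!\!\int_t^T|B(s,X(s))^T\Phi(T,s)^T\bar G\,\Phi(T,r)B(r,X(r))|^2drds\Big]^{1/2},\\ \hat Q(s,t)&=\int_s^T\Big[\int_t^\tau\!\!\int_t^\tau|B(r,X(r))^T\Phi(\tau,r)^T\bar Q(\tau)\Phi(\tau,r')B(r',X(r'))|^2dr'dr\Big]^{1/2}d\tau,\end{aligned}$$ and the function of $\tau$ integrated in $\hat Q(t,t)$ is assumed Lebesgue integrable on $[t,T]$. Then $D_{uu}J(t,x;u)\ge\delta I$. -/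

import Mathlib

open MeasureTheory Set
open scoped InnerProductSpace

noncomputable section

/-- `ℝᵏ` with its Euclidean norm. -/
abbrev RVec (k : ℕ) : Type := EuclideanSpace ℝ (Fin k)

/-- Matrices `ℝ^{k × l}`, regarded as linear maps `ℝˡ → ℝᵏ`. The norm is the operator norm, the
transpose is the adjoint `ContinuousLinearMap.adjoint`, `≤` is the Loewner order (`M ≤ N` means that
`N - M` is symmetric and positive semidefinite), and `1` is the identity matrix. -/
abbrev RMat (k l : ℕ) : Type := RVec l →L[ℝ] RVec k

/-- The control space `𝒰[t, T] = L²(t, T; ℝᵐ)` (all controls, that is, `U = ℝᵐ`). -/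
abbrev ControlSpace (m : ℕ) (t T : ℝ) : Type :=
  Lp (RVec m) 2 ((volume : Measure ℝ).restrict (Ioc t T))

/-- The Hessian matrix `f_xx(x)` of a scalar function, as the derivative of its gradient. -/
def hessian {n : ℕ} (f : RVec n → ℝ) (x : RVec n) : RMat n n :=
  fderiv ℝ (fun z => gradient f z) x

/-- The data of an affine-quadratic control problem: the horizon `T` and the coefficients of the
state equation `Ẋ = A(s, X) + B(s, X) u` and of the cost
`∫ [Q(s, X) + ⟨S(s, X), u⟩ + ½ ⟨R(s, X) u, u⟩] ds + G(X(T))`. Only times in `[0, T]` matter. -/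
structure AQProblem (n m : ℕ) where
  T : ℝ
  A : ℝ → RVec n → RVec n
  B : ℝ → RVec n → RMat n m
  Q : ℝ → RVec n → ℝ
  S : ℝ → RVec n → RVec m
  R : ℝ → RVec n → RMat m m
  G : RVec n → ℝ

namespace AQProblem

variable {n m : ℕ} (P : AQProblem n m)

/-- The domain `[0, T] × ℝⁿ` of the coefficients. -/
def domain : Set (ℝ × RVec n) := Icc 0 P.T ×ˢ univ

/-- Hypothesis (H1) on the state equation, for `U = ℝᵐ`. -/
structure H1 : Prop where
  continuous_A : ContinuousOn (fun p : ℝ × RVec n => P.A p.1 p.2) P.domain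
  continuous_B : ContinuousOn (fun p : ℝ × RVec n => P.B p.1 p.2) P.domain
  lipschitz_A : ∃ LA > (0 : ℝ), ∀ t ∈ Icc 0 P.T, ∀ x y : RVec n,
    ‖P.A t x - P.A t y‖ ≤ LA * ‖x - y‖
  lipschitz_B : ∃ LB' > (0 : ℝ), ∀ t ∈ Icc 0 P.T, ∀ x y : RVec n,
    ‖P.B t x - P.B t y‖ ≤ LB' * ‖x - y‖
  one_sided_B : ∃ LB > (0 : ℝ), ∀ t ∈ Icc 0 P.T, ∀ (u : RVec m) (x y : RVec n),
    ⟪(P.B t x - P.B t y).adjoint (x - y), u⟫_ℝ ≤ LB * ‖x - y‖ ^ 2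

/-- Hypothesis (H2) on the cost. -/
structure H2 : Prop where
  continuous_Q : ContinuousOn (fun p : ℝ × RVec n => P.Q p.1 p.2) P.domain
  continuous_S : ContinuousOn (fun p : ℝ × RVec n => P.S p.1 p.2) P.domain
  continuous_R : ContinuousOn (fun p : ℝ × RVec n => P.R p.1 p.2) P.domain
  continuous_G : Continuous P.G
  symmetric_R : ∀ t ∈ Icc 0 P.T, ∀ x : RVec n, (P.R t x).adjoint = P.R t x
  bounds : ∃ L > (0 : ℝ), ∃ Q₀ > (0 : ℝ), ∃ G₀ > (0 : ℝ), ∃ S₀ > (0 : ℝ),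
    ∃ ε₀ ∈ Ioo (0 : ℝ) 1, ∃ ρ₀ > (0 : ℝ), ∃ ρ : RVec n → ℝ,
      Continuous ρ ∧ (∀ x, ρ₀ ≤ ρ x) ∧ (∀ x, -L ≤ P.G x ∧ P.G x ≤ G₀ * (1 + ‖x‖ ^ 2)) ∧
      ∀ t ∈ Icc 0 P.T, ∀ x : RVec n,
        ρ x • (1 : RMat m m) ≤ P.R t x ∧
        -L ≤ (1 - ε₀) * P.Q t x - 1 / 2 * ⟪P.S t x, (P.R t x).inverse (P.S t x)⟫_ℝ ∧
        P.Q t x ≤ Q₀ * (1 + ‖x‖ ^ 2) ∧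
        ‖P.S t x‖ ≤ S₀ * (1 + ‖x‖) ∧
        ‖P.A t x + P.B t x ((P.R t x).inverse (P.S t x))‖ ≤ L * (1 + ‖x‖) ∧
        ‖P.B t x ∘L (P.R t x).inverse ∘L (P.B t x).adjoint‖ ≤ L

/-- Hypothesis (H3): the coefficients are twice continuously differentiable. -/
structure H3 : Prop where
  smooth_A : ContDiffOn ℝ 2 (fun p : ℝ × RVec n => P.A p.1 p.2) P.domain
  smooth_B : ContDiffOn ℝ 2 (fun p : ℝ × RVec n => P.B p.1 p.2) P.domain
  smooth_Q : ContDiffOn ℝ 2 (fun p : ℝ × RVec n => P.Q p.1 p.2) P.domain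
  smooth_S : ContDiffOn ℝ 2 (fun p : ℝ × RVec n => P.S p.1 p.2) P.domain
  smooth_R : ContDiffOn ℝ 2 (fun p : ℝ × RVec n => P.R p.1 p.2) P.domain
  smooth_G : ContDiff ℝ 2 P.G

/-- `X` solves `Ẋ(s) = A(s, X(s)) + B(s, X(s)) u(s)` on `[t, T]`, `X(t) = x` (in the sense of
Carathéodory, that is, in integrated form). -/
def IsState (t : ℝ) (x : RVec n) (u : ControlSpace m t P.T) (X : ℝ → RVec n) : Prop :=
  ContinuousOn X (Icc t P.T) ∧
    ∀ s ∈ Icc t P.T, X s = x + ∫ r in t..s, (P.A r (X r) + P.B r (X r) (u r))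

open Classical in
/-- The state trajectory `X(·; t, x, u)`: the solution of the state equation on `[t, T]`, which
exists and is unique on `[t, T]` when the coefficients are Lipschitz (the value in the other case is
irrelevant). -/
def state (t : ℝ) (x : RVec n) (u : ControlSpace m t P.T) : ℝ → RVec n :=
  if h : ∃ X, P.IsState t x u X then h.choose else fun _ => x

/-- The cost functional `J(t, x; u)`. -/
def J (t : ℝ) (x : RVec n) (u : ControlSpace m t P.T) : ℝ :=
  (∫ s in t..P.T, (P.Q s (P.state t x u s) + ⟪P.S s (P.state t x u s), u s⟫_ℝ
      + 1 / 2 * ⟪P.R s (P.state t x u s) (u s), u s⟫_ℝ))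
    + P.G (P.state t x u P.T)

/-- The first derivative `D_u J(t, x; u) ∈ L²(t, T; ℝᵐ)` (through the Riesz isomorphism). -/
def DuJ (t : ℝ) (x : RVec n) (u : ControlSpace m t P.T) : ControlSpace m t P.T :=
  gradient (P.J t x) u

/-- The second derivative `D_uu J(t, x; u)`, a bounded operator on `L²(t, T; ℝᵐ)`: the Fréchet
derivative of `u ↦ D_u J(t, x; u)`. -/
def DuuJ (t : ℝ) (x : RVec n) (u : ControlSpace m t P.T) :
    ControlSpace m t P.T →L[ℝ] ControlSpace m t P.T :=
  fderiv ℝ (P.DuJ t x) u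

/-- `𝐀 = A_x(s, x) + ∑ⱼ uʲ B_xʲ(s, x)`, where `Bʲ` is the `j`-th column of `B`. -/
def bA (s : ℝ) (x : RVec n) (u : RVec m) : RMat n n :=
  fderiv ℝ (P.A s) x + fderiv ℝ (fun z => P.B s z u) x

/-- `𝐀₁ = ∑ᵢ yⁱ Aⁱ_xx + Q_xx + ½ ∑ⱼₖ uʲ uᵏ Rʲᵏ_xx + ∑ⱼ uʲ (∑ᵢ yⁱ Bⁱʲ_xx + Sʲ_xx)` at `(s, x)`;
here `y` and `u` are constant vectors, so each sum is the Hessian of the contracted function. -/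
def bA₁ (s : ℝ) (x y : RVec n) (u : RVec m) : RMat n n :=
  hessian (fun z => ⟪y, P.A s z⟫_ℝ) x
    + hessian (P.Q s) x
    + (1 / 2 : ℝ) • hessian (fun z => ⟪P.R s z u, u⟫_ℝ) x
    + (hessian (fun z => ⟪y, P.B s z u⟫_ℝ) x + hessian (fun z => ⟪P.S s z, u⟫_ℝ) x)

/-- `𝐂 = ∑ⱼ uʲ Rʲ_x(s, x) + S_x(s, x) + ∑ᵢ yⁱ B̃ⁱ_x(s, x)`, where `Rʲ` is the `j`-th column of `R`
and `B̃ⁱ` is the `i`-th column of the transpose of `B`. -/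
def bC (s : ℝ) (x y : RVec n) (u : RVec m) : RMat m n :=
  fderiv ℝ (fun z => P.R s z u) x + fderiv ℝ (P.S s) x
    + fderiv ℝ (fun z => (P.B s z).adjoint y) x

/-- `Y` solves the adjoint equation
`Ẏ(s) = -𝐀(s)ᵀ Y(s) - Q_x(s, X)ᵀ - S_x(s, X)ᵀ u(s) - ½ ∑ⱼₖ uʲ(s) uᵏ(s) Rʲᵏ_x(s, X)ᵀ` on `[t, T]`,
`Y(T) = G_x(X(T))ᵀ`, in integrated form. -/
def IsAdjointState (t : ℝ) (u : ControlSpace m t P.T) (X Y : ℝ → RVec n) : Prop :=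
  ContinuousOn Y (Icc t P.T) ∧
    ∀ s ∈ Icc t P.T, Y s = gradient P.G (X P.T) +
      ∫ r in s..P.T, ((P.bA r (X r) (u r)).adjoint (Y r) + gradient (P.Q r) (X r)
        + (fderiv ℝ (P.S r) (X r)).adjoint (u r)
        + (1 / 2 : ℝ) • gradient (fun z => ⟪P.R r z (u r), u r⟫_ℝ) (X r))

/-- `Φ(s, τ)`, `t ≤ τ ≤ s ≤ T`, is the fundamental matrix of the matrix function `M` on `[t, T]`:
`d/ds Φ(s, τ) = M(s) Φ(s, τ)`, `Φ(τ, τ) = I`, in integrated form. -/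
def IsFundamentalMatrix (t : ℝ) (M : ℝ → RMat n n) (Φ : ℝ → ℝ → RMat n n) : Prop :=
  ∀ τ ∈ Icc t P.T, ContinuousOn (fun s => Φ s τ) (Icc τ P.T) ∧
    ∀ s ∈ Icc τ P.T, Φ s τ = 1 + ∫ r in τ..s, M r ∘L Φ r τ

/-- `∫_t^s Φ(s, r) B(r, X(r)) v(r) dr`. -/
def linResponse (t : ℝ) (X : ℝ → RVec n) (Φ : ℝ → ℝ → RMat n n)
    (v : ControlSpace m t P.T) (s : ℝ) : RVec n :=
  ∫ r in t..s, Φ s r (P.B r (X r) (v r))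

/-- The kernel `B(r, X(r))ᵀ Φ(τ, r)ᵀ M Φ(τ, r') B(r', X(r'))`. -/
def kernel (X : ℝ → RVec n) (Φ : ℝ → ℝ → RMat n n) (M : RMat n n) (τ r r' : ℝ) : RMat m m :=
  (P.B r (X r)).adjoint ∘L (Φ τ r).adjoint ∘L M ∘L Φ τ r' ∘L P.B r' (X r')

/-- `[∫_t^τ ∫_t^τ |B(r, X(r))ᵀ Φ(τ, r)ᵀ M Φ(τ, r') B(r', X(r'))|² dr' dr]^{1/2}`. -/
def kernelNorm (t : ℝ) (X : ℝ → RVec n) (Φ : ℝ → ℝ → RMat n n) (M : RMat n n) (τ : ℝ) : ℝ :=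
  Real.sqrt (∫ r in t..τ, ∫ r' in t..τ, ‖P.kernel X Φ M τ r r'‖ ^ 2)

/-- `Ĝ(t)`. -/
def GHat (t : ℝ) (X : ℝ → RVec n) (Φ : ℝ → ℝ → RMat n n) (Gbar : RMat n n) : ℝ :=
  P.kernelNorm t X Φ Gbar P.T

/-- `Q̂(s, t)`. -/
def QHat (t : ℝ) (X : ℝ → RVec n) (Φ : ℝ → ℝ → RMat n n) (Qbar : ℝ → RMat n n) (s : ℝ) : ℝ :=
  ∫ τ in s..P.T, P.kernelNorm t X Φ (Qbar τ) τ

end AQProblem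

end

/-! Part (a). The state equation reads `X = x + I(A(·,X) + B(·,X)u)` with the primitive `I : L¹ →
C([t,T])`. For twice differentiable coefficients, superposition is a C² operator on `C([t,T])`
(`C2Coeff.contDiff`), and multiplication `C × L² → L¹` is bounded bilinear, so this is a C² equation
in `(u,X)`. Its partial derivative in `X` is the identity minus a linear Volterra operator whose
kernel is bounded by `κ₁ + κ₂|u|`, a square integrable function. Such an operator is bijective
(`existsUnique_volterra`), so the implicit function theorem makes `u ↦ X` of class C²
(`contDiff_stateMap`), and `J` is C² as a composition.

The second derivative is computed along lines `u + εv`. Differentiating the state equation twice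
gives linear equations for the first and second variations `X₁`, `X₂` (`stateMap_hasJet2`). In the
second derivative of `J`, the variation `X₂` enters only linearly, through the first-order terms of
the running cost and through `G_x`. The adjoint state `Y` removes it: the product rule for `⟨Y,X₂⟩`
(`inner_adjoint_terminal`) trades these terms for `Y` paired with the quadratic source in the
equation of `X₂`. What remains is the quadratic form with blocks `R`, `𝐀₁`, `𝐂` and `G_xx`; the
symmetry of `R` merges the two cross terms that contain `R_x`. Variation of constants identifies
`X₁` with the integral against `Φ` (`linResponse_eq`).

Part (b). Completing the square in `v` costs a fraction `α` of `R` and, by the condition on `𝐀₁`,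
bounds the integrand below by `(1-α)⟨Rv,v⟩ - ⟨Q̄X₁,X₁⟩`. Since `X₁(τ)` is a linear integral of `v`,
two applications of Cauchy–Schwarz bound `⟨Q̄(τ)X₁(τ),X₁(τ)⟩` by a Hilbert–Schmidt norm times `∫_t^τ
|v|²` (`inner_integral_le_hilbertSchmidt`). Integrating in `τ` by parts turns this into `∫
Q̂(s,t)|v(s)|² ds`; the terminal term likewise costs `Ĝ(t)∫|v|²`. The last assumption then leaves
`δ|v|²` pointwise. Symmetry of the operator, which the order also requires, is the symmetry of
second derivatives of `J`. -/

set_option linter.unusedSectionVars false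

noncomputable section

open scoped ENNReal

/-! ### Differentiability of superposition operators on spaces of continuous functions. -/

section Superposition

/-- The superposition operator `X ↦ (s ↦ g (s, X s))` on continuous functions. -/
def superpose {K E V : Type*} [TopologicalSpace K] [TopologicalSpace E] [TopologicalSpace V]
    (g : C(K × E, V)) (X : C(K, E)) : C(K, V) :=
  g.comp ((ContinuousMap.id K).prodMk X)

@[simp] theorem superpose_apply {K E V : Type*} [TopologicalSpace K] [TopologicalSpace E]
    [TopologicalSpace V] (g : C(K × E, V)) (X : C(K, E)) (s : K) :
    superpose g X s = g (s, X s) := rfl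

theorem continuous_superpose {K E V : Type*} [TopologicalSpace K] [LocallyCompactSpace K]
    [TopologicalSpace E] [TopologicalSpace V] (g : C(K × E, V)) : Continuous (superpose g) := by
  refine ContinuousMap.continuous_of_continuous_uncurry _ ?_
  have : Continuous fun p : C(K, E) × K => g (p.2, p.1 p.2) := by fun_prop
  exact this

variable {K E V W : Type*} [TopologicalSpace K] [CompactSpace K] [LocallyCompactSpace K]
  [NormedAddCommGroup E] [NormedSpace ℝ E] [NormedAddCommGroup V] [NormedSpace ℝ V]
  [NormedAddCommGroup W] [NormedSpace ℝ W]

/-- A bounded bilinear map acting pointwise on continuous functions. -/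
def pointwiseBilin (B : V →L[ℝ] E →L[ℝ] W) : C(K, V) →L[ℝ] C(K, E) →L[ℝ] C(K, W) :=
  LinearMap.mkContinuous₂
    (LinearMap.mk₂ ℝ (fun (a : C(K, V)) (h : C(K, E)) =>
        (⟨fun s => B (a s) (h s), by fun_prop⟩ : C(K, W)))
      (fun a b h => by ext s; simp) (fun c a h => by ext s; simp)
      (fun a h k => by ext s; simp) (fun c a h => by ext s; simp)) ‖B‖
    (fun a h => by
      refine (ContinuousMap.norm_le _ (by positivity)).2 fun s => ?_
      refine (B.le_opNorm₂ _ _).trans ?_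
      gcongr
      · exact a.norm_coe_le_norm s
      · exact h.norm_coe_le_norm s)

@[simp] theorem pointwiseBilin_apply (B : V →L[ℝ] E →L[ℝ] W) (a : C(K, V)) (h : C(K, E)) (s : K) :
    pointwiseBilin B a h s = B (a s) (h s) := rfl

/-- Pointwise application of operator-valued continuous functions. -/
def pointwiseApply : C(K, E →L[ℝ] V) →L[ℝ] C(K, E) →L[ℝ] C(K, V) :=
  pointwiseBilin (ContinuousLinearMap.id ℝ (E →L[ℝ] V))

@[simp] theorem pointwiseApply_apply (a : C(K, E →L[ℝ] V)) (h : C(K, E)) (s : K) :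
    pointwiseApply a h s = a s (h s) := rfl

/-- This is continuity of the superposition operator at `X`, tested on the translate of `X` by the
constant `z - X s`, which takes the value `z` at `s`. Arguing through the compact-open topology
avoids local compactness of `E`. -/
theorem exists_uniform_modulus (g : C(K × E, V)) (X : C(K, E)) {c : ℝ} (hc : 0 < c) :
    ∃ δ > 0, ∀ s z, ‖z - X s‖ < δ → ‖g (s, z) - g (s, X s)‖ < c := by
  obtain ⟨δ, hδ, hclose⟩ := Metric.continuousAt_iff.1
    (continuous_superpose g).continuousAt c hc
  refine ⟨δ, hδ, fun s z hz => ?_⟩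
  have h1 := @hclose (X + ContinuousMap.const K (z - X s)) (by
    rw [dist_eq_norm, add_sub_cancel_left]
    exact lt_of_le_of_lt
      ((ContinuousMap.norm_le _ (norm_nonneg (z - X s))).2 fun _ => le_rfl) hz)
  rw [dist_eq_norm] at h1
  simpa using (ContinuousMap.norm_coe_le_norm _ s).trans_lt h1

/-- At each `s` the mean value inequality on a ball around `X s` bounds the remainder by `c‖h‖`. The
radius does not depend on `s`, so the bound passes to the supremum norm. -/
theorem hasFDerivAt_superpose (g : C(K × E, V)) (g' : C(K × E, E →L[ℝ] V))
    (hg : ∀ s x, HasFDerivAt (fun z => g (s, z)) (g' (s, x)) x) (X : C(K, E)) :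
    HasFDerivAt (superpose g) (pointwiseApply (superpose g' X)) X := by
  rw [hasFDerivAt_iff_isLittleO_nhds_zero, Asymptotics.isLittleO_iff]
  intro c hc
  obtain ⟨δ, hδ, hclose⟩ := exists_uniform_modulus g' X hc
  filter_upwards [Metric.ball_mem_nhds (0 : C(K, E)) hδ] with h hh
  rw [mem_ball_zero_iff] at hh
  refine (ContinuousMap.norm_le _ (by positivity)).2 fun s => ?_
  have hbound : ∀ z ∈ Metric.ball (X s) δ, ‖g' (s, z) - g' (s, X s)‖ ≤ c := fun z hz =>
    (hclose s z (by rwa [Metric.mem_ball, dist_eq_norm] at hz)).le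
  have key := (convex_ball (X s) δ).norm_image_sub_le_of_norm_hasFDerivWithin_le'
    (f := fun z => g (s, z)) (f' := fun z => g' (s, z)) (φ := g' (s, X s)) (C := c)
    (fun z _ => (hg s z).hasFDerivWithinAt) hbound (Metric.mem_ball_self hδ)
    (y := X s + h s) (by
      rw [Metric.mem_ball, dist_eq_norm, add_sub_cancel_left]
      exact (h.norm_coe_le_norm s).trans_lt hh)
  rw [add_sub_cancel_left] at key
  refine (le_of_eq ?_).trans (key.trans ?_)
  · simp
  · gcongr
    exact h.norm_coe_le_norm s

variable (K E V) in
/-- A coefficient `f₀ : K × E → V`, twice differentiable in the second variable, with jointly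
continuous derivatives `f₁` and `f₂`. -/
structure C2Coeff where
  f₀ : C(K × E, V)
  f₁ : C(K × E, E →L[ℝ] V)
  f₂ : C(K × E, E →L[ℝ] E →L[ℝ] V)
  hasFDerivAt₀ : ∀ s x, HasFDerivAt (fun z => f₀ (s, z)) (f₁ (s, x)) x
  hasFDerivAt₁ : ∀ s x, HasFDerivAt (fun z => f₁ (s, z)) (f₂ (s, x)) x

/-- The first derivative is the superposition operator of `f₁` followed by a fixed bounded linear
map, so the first-order result applies once more. -/
theorem C2Coeff.hasFDerivAt_deriv (g : C2Coeff K E V) (X : C(K, E)) :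
    HasFDerivAt (fun X : C(K, E) => pointwiseApply (superpose g.f₁ X))
      ((pointwiseApply : C(K, E →L[ℝ] V) →L[ℝ] C(K, E) →L[ℝ] C(K, V)).comp
        (pointwiseApply (superpose g.f₂ X))) X := by
  have h := hasFDerivAt_superpose g.f₁ g.f₂ g.hasFDerivAt₁ X
  exact (pointwiseApply : C(K, E →L[ℝ] V) →L[ℝ] C(K, E) →L[ℝ] C(K, V)).hasFDerivAt.comp X h

theorem C2Coeff.contDiff (g : C2Coeff K E V) : ContDiff ℝ 2 (superpose g.f₀) := by
  have h1 : ContDiff ℝ 1 fun X : C(K, E) => pointwiseApply (superpose g.f₁ X) := by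
    refine contDiff_one_iff_hasFDerivAt.2 ⟨_, ?_, g.hasFDerivAt_deriv⟩
    have h2 : Continuous fun X : C(K, E) =>
        (pointwiseApply (superpose g.f₂ X) : C(K, E) →L[ℝ] C(K, E →L[ℝ] V)) := by
      have h := continuous_superpose g.f₂
      exact (ContinuousLinearMap.continuous _).comp h
    exact continuous_const.clm_comp h2
  have h3 : ContDiff ℝ (1 + 1) (superpose g.f₀) :=
    contDiff_succ_iff_hasFDerivAt.2 ⟨_, h1, hasFDerivAt_superpose g.f₀ g.f₁ g.hasFDerivAt₀⟩
  simpa [one_add_one_eq_two] using h3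

end Superposition

/-! ### Second-order jets of curves and their calculus. -/

section Jets

variable {E F V W : Type*} [NormedAddCommGroup E] [NormedSpace ℝ E] [NormedAddCommGroup F]
  [NormedSpace ℝ F] [NormedAddCommGroup V] [NormedSpace ℝ V] [NormedAddCommGroup W]
  [NormedSpace ℝ W]

/-- The curve `c` is differentiable, and at time `0` it has first derivative `c₁` and second
derivative `c₂`. -/
def HasJet2 (c : ℝ → E) (c₁ c₂ : E) : Prop :=
  ∃ c' : ℝ → E, (∀ ε, HasDerivAt c (c' ε) ε) ∧ c' 0 = c₁ ∧ HasDerivAt c' c₂ 0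

namespace HasJet2

/-- The tool that computes derivatives below: a jet that exists by smoothness is compared with the
jet of an explicit expression for the same curve. -/
theorem unique {c : ℝ → E} {c₁ c₂ d₁ d₂ : E} (h : HasJet2 c c₁ c₂) (k : HasJet2 c d₁ d₂) :
    c₁ = d₁ ∧ c₂ = d₂ := by
  obtain ⟨c', h1, rfl, h2⟩ := h
  obtain ⟨d', k1, rfl, k2⟩ := k
  obtain rfl : c' = d' := funext fun ε => (h1 ε).unique (k1 ε)
  exact ⟨rfl, h2.unique k2⟩

theorem const (x : E) : HasJet2 (fun _ => x) 0 0 :=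
  ⟨fun _ => 0, fun ε => hasDerivAt_const ε x, rfl, hasDerivAt_const 0 0⟩

theorem line (u v : E) : HasJet2 (fun ε : ℝ => u + ε • v) v 0 :=
  ⟨fun _ => v, fun ε => by simpa using ((hasDerivAt_id ε).smul_const v).const_add u, rfl,
    hasDerivAt_const 0 v⟩

theorem add {c d : ℝ → E} {c₁ c₂ d₁ d₂ : E} (h : HasJet2 c c₁ c₂) (k : HasJet2 d d₁ d₂) :
    HasJet2 (fun ε => c ε + d ε) (c₁ + d₁) (c₂ + d₂) := by
  obtain ⟨c', h1, rfl, h2⟩ := h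
  obtain ⟨d', k1, rfl, k2⟩ := k
  exact ⟨fun ε => c' ε + d' ε, fun ε => (h1 ε).add (k1 ε), rfl, h2.add k2⟩

theorem clm (L : E →L[ℝ] F) {c : ℝ → E} {c₁ c₂ : E} (h : HasJet2 c c₁ c₂) :
    HasJet2 (fun ε => L (c ε)) (L c₁) (L c₂) := by
  obtain ⟨c', h1, rfl, h2⟩ := h
  exact ⟨fun ε => L (c' ε), fun ε => L.hasFDerivAt.comp_hasDerivAt ε (h1 ε), rfl,
    L.hasFDerivAt.comp_hasDerivAt 0 h2⟩

theorem bilin (B : E →L[ℝ] F →L[ℝ] V) {c : ℝ → E} {c₁ c₂ : E} {d : ℝ → F} {d₁ d₂ : F}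
    (h : HasJet2 c c₁ c₂) (k : HasJet2 d d₁ d₂) :
    HasJet2 (fun ε => B (c ε) (d ε)) (B c₁ (d 0) + B (c 0) d₁)
      (B c₂ (d 0) + (2 : ℝ) • B c₁ d₁ + B (c 0) d₂) := by
  obtain ⟨c', h1, rfl, h2⟩ := h
  obtain ⟨d', k1, rfl, k2⟩ := k
  have key : ∀ {c : ℝ → E} {c' : E} {d : ℝ → F} {d' : F} {ε : ℝ}, HasDerivAt c c' ε →
      HasDerivAt d d' ε → HasDerivAt (fun ε => B (c ε) (d ε)) (B c' (d ε) + B (c ε) d') ε := by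
    intro c c' d d' ε hc hd
    exact (B.hasFDerivAt.comp_hasDerivAt ε hc).clm_apply hd
  refine ⟨fun ε => B (c' ε) (d ε) + B (c ε) (d' ε), fun ε => key (h1 ε) (k1 ε), rfl, ?_⟩
  refine ((key h2 (k1 0)).add (key (h1 0) k2)).congr_deriv ?_
  rw [two_smul]
  abel

theorem comp {Ψ : E → F} {Ψ' : E → E →L[ℝ] F} {Ψ'' : E →L[ℝ] E →L[ℝ] F} {c : ℝ → E} {c₁ c₂ : E}
    (h1 : ∀ x, HasFDerivAt Ψ (Ψ' x) x) (h2 : HasFDerivAt Ψ' Ψ'' (c 0)) (hc : HasJet2 c c₁ c₂) :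
    HasJet2 (fun ε => Ψ (c ε)) (Ψ' (c 0) c₁) (Ψ'' c₁ c₁ + Ψ' (c 0) c₂) := by
  obtain ⟨c', k1, rfl, k2⟩ := hc
  exact ⟨fun ε => Ψ' (c ε) (c' ε), fun ε => (h1 (c ε)).comp_hasDerivAt ε (k1 ε), rfl,
    (h2.comp_hasDerivAt 0 (k1 0)).clm_apply k2⟩

theorem comp_contDiff {Ψ : E → F} (hΨ : ContDiff ℝ 2 Ψ) {c : ℝ → E} {c₁ c₂ : E}
    (hc : HasJet2 c c₁ c₂) :
    HasJet2 (fun ε => Ψ (c ε)) (fderiv ℝ Ψ (c 0) c₁)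
      (fderiv ℝ (fderiv ℝ Ψ) (c 0) c₁ c₁ + fderiv ℝ Ψ (c 0) c₂) := by
  refine hc.comp (fun x => (hΨ.differentiable (by norm_num) x).hasFDerivAt) ?_
  exact ((hΨ.fderiv_right (m := 1) (by norm_num)).differentiable (by norm_num) _).hasFDerivAt

theorem superposition {K : Type*} [TopologicalSpace K] [CompactSpace K] [LocallyCompactSpace K]
    (g : C2Coeff K E V)
    {c : ℝ → C(K, E)} {c₁ c₂ : C(K, E)} (hc : HasJet2 c c₁ c₂) :
    HasJet2 (fun ε => superpose g.f₀ (c ε)) (pointwiseApply (superpose g.f₁ (c 0)) c₁)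
      (pointwiseApply (pointwiseApply (superpose g.f₂ (c 0)) c₁) c₁
        + pointwiseApply (superpose g.f₁ (c 0)) c₂) := by
  have h0 := hasFDerivAt_superpose g.f₀ g.f₁ g.hasFDerivAt₀
  have h1 := g.hasFDerivAt_deriv (c 0)
  have h := HasJet2.comp h0 h1 hc
  rw [ContinuousLinearMap.comp_apply] at h
  exact h

end HasJet2

end Jets

/-! ### The product rule for absolutely continuous functions, in integrated form. -/

section Primitives

variable {E F G : Type*} [NormedAddCommGroup E] [NormedSpace ℝ E] [CompleteSpace E]
  [NormedAddCommGroup F] [NormedSpace ℝ F] [CompleteSpace F]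
  [NormedAddCommGroup G] [NormedSpace ℝ G] [CompleteSpace G]

theorem intervalIntegrable_bilin_left (B : E →L[ℝ] F →L[ℝ] G) {a b : ℝ} (hab : a ≤ b) {f : ℝ → E}
    {g : ℝ → F} (hf : IntervalIntegrable f volume a b) (hg : ContinuousOn g (Icc a b)) :
    IntervalIntegrable (fun r => B (f r) (g r)) volume a b := by
  rw [intervalIntegrable_iff_integrableOn_Ioc_of_le hab] at hf ⊢
  obtain ⟨C, hC⟩ := isCompact_Icc.exists_bound_of_continuousOn hg
  refine (hf.norm.const_mul (‖B‖ * C)).mono' ?_ ?_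
  · exact B.aestronglyMeasurable_comp₂ hf.aestronglyMeasurable
      ((hg.mono Ioc_subset_Icc_self).aestronglyMeasurable measurableSet_Ioc)
  · filter_upwards [ae_restrict_mem measurableSet_Ioc] with r hr
    refine (B.le_opNorm₂ _ _).trans ?_
    have := hC r (Ioc_subset_Icc_self hr)
    calc ‖B‖ * ‖f r‖ * ‖g r‖ ≤ ‖B‖ * ‖f r‖ * C := by gcongr
      _ = _ := by ring

/-- The product rule for primitives of integrable functions, both vanishing at the left end. -/
theorem bilin_integral_integral (B : E →L[ℝ] F →L[ℝ] G) {a b : ℝ} (hab : a ≤ b) {f : ℝ → E}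
    {g : ℝ → F} (hf : IntervalIntegrable f volume a b) (hg : IntervalIntegrable g volume a b) :
    B (∫ r in a..b, f r) (∫ r in a..b, g r) =
      ∫ r in a..b, (B (f r) (∫ r' in a..r, g r') + B (∫ r' in a..r, f r') (g r)) := by
  have hf' := hf
  have hg' := hg
  rw [intervalIntegrable_iff_integrableOn_Ioc_of_le hab] at hf hg
  set μ := (volume : Measure ℝ).restrict (Ioc a b) with hμ
  -- By Fubini the left side is the integral of `B (f r) (g r')` over the square. The triangle `r' ≤
  -- r` gives the first term on the right and its complement gives the second.
  have hint : Integrable (fun z : ℝ × ℝ => B (f z.1) (g z.2)) (μ.prod μ) :=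
    hf.op_fst_snd (by fun_prop) ⟨‖B‖, B.le_opNorm₂⟩ hg
  have hS : MeasurableSet {z : ℝ × ℝ | z.2 ≤ z.1} :=
    (isClosed_le continuous_snd continuous_fst).measurableSet
  have e1 : ∀ r ∈ Ioc a b, (∫ y, {z : ℝ × ℝ | z.2 ≤ z.1}.indicator
      (fun z => B (f z.1) (g z.2)) (r, y) ∂μ) = B (f r) (∫ r' in a..r, g r') := by
    intro r hr
    have hgr : IntegrableOn g (Ioc a r) := hg.mono_set (Ioc_subset_Ioc_right hr.2)
    rw [intervalIntegral.integral_of_le hr.1.le, ← (B (f r)).integral_comp_comm hgr]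
    have : (fun y => {z : ℝ × ℝ | z.2 ≤ z.1}.indicator (fun z => B (f z.1) (g z.2)) (r, y))
        = (Iic r).indicator (fun y => B (f r) (g y)) := by
      ext y; simp [indicator]
    rw [this, integral_indicator measurableSet_Iic, hμ, Measure.restrict_restrict measurableSet_Iic]
    congr 2
    ext y; simp only [mem_inter_iff, mem_Iic, mem_Ioc]
    constructor
    · rintro ⟨h1, h2, h3⟩; exact ⟨h2, h1⟩
    · rintro ⟨h1, h2⟩; exact ⟨h2, h1, h2.trans hr.2⟩
  have e2 : ∀ r ∈ Ioc a b, (∫ y, {z : ℝ × ℝ | z.2 ≤ z.1}ᶜ.indicator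
      (fun z => B (f z.1) (g z.2)) (y, r) ∂μ) = B (∫ r' in a..r, f r') (g r) := by
    intro r hr
    have hfr : IntegrableOn f (Ioc a r) := hf.mono_set (Ioc_subset_Ioc_right hr.2)
    rw [intervalIntegral.integral_of_le hr.1.le]
    have h3 : B (∫ r' in Ioc a r, f r') (g r) = ∫ r' in Ioc a r, B (f r') (g r) :=
      ((B.flip (g r)).integral_comp_comm hfr).symm
    have : (fun y => {z : ℝ × ℝ | z.2 ≤ z.1}ᶜ.indicator (fun z => B (f z.1) (g z.2)) (y, r))
        = (Iio r).indicator (fun y => B (f y) (g r)) := by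
      ext y; simp [indicator]
    rw [h3, this, integral_indicator measurableSet_Iio, hμ,
      Measure.restrict_restrict measurableSet_Iio, ← integral_Ioc_eq_integral_Ioo.symm]
    congr 2
    ext y; simp only [mem_inter_iff, mem_Iio, mem_Ioc, mem_Ioo]
    constructor
    · rintro ⟨h1, h2, h3⟩; exact ⟨h2, h1⟩
    · rintro ⟨h1, h2⟩; exact ⟨h2, h1, h2.le.trans hr.2⟩
  have hcg : ContinuousOn (fun r => ∫ r' in a..r, g r') (Icc a b) := by
    have := intervalIntegral.continuousOn_primitive_interval' hg' (left_mem_uIcc)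
    rwa [uIcc_of_le hab] at this
  have hcf : ContinuousOn (fun r => ∫ r' in a..r, f r') (Icc a b) := by
    have := intervalIntegral.continuousOn_primitive_interval' hf' (left_mem_uIcc)
    rwa [uIcc_of_le hab] at this
  have i1 := intervalIntegrable_bilin_left B hab hf' hcg
  have i2 := intervalIntegrable_bilin_left B.flip hab hg' hcf
  simp only [ContinuousLinearMap.flip_apply] at i2
  rw [intervalIntegral.integral_add i1 i2, intervalIntegral.integral_of_le hab,
    intervalIntegral.integral_of_le hab, ← integral_prod_bilin B hf hg, 
    intervalIntegral.integral_of_le hab, intervalIntegral.integral_of_le hab,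
    ← integral_add_compl hS hint, ← integral_indicator hS, ← integral_indicator hS.compl,
    integral_prod _ (hint.indicator hS), integral_prod_symm _ (hint.indicator hS.compl)]
  congr 1
  · exact setIntegral_congr_fun measurableSet_Ioc e1
  · exact setIntegral_congr_fun measurableSet_Ioc e2

theorem continuousOn_of_eq_add_integral {a b : ℝ} (hab : a ≤ b) {f φ : ℝ → E} {c : E}
    (hφ : IntervalIntegrable φ volume a b) (hf : ∀ s ∈ Icc a b, f s = c + ∫ r in a..s, φ r) :
    ContinuousOn f (Icc a b) := by
  have := intervalIntegral.continuousOn_primitive_interval' hφ (left_mem_uIcc)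
  rw [uIcc_of_le hab] at this
  exact (continuousOn_const.add this).congr hf

/-- The product rule for absolutely continuous functions, in integrated form. -/
theorem bilin_eq_add_integral (B : E →L[ℝ] F →L[ℝ] G) {a b : ℝ} (hab : a ≤ b) {f φ : ℝ → E}
    {g γ : ℝ → F} (hφ : IntervalIntegrable φ volume a b) (hγ : IntervalIntegrable γ volume a b)
    (hf : ∀ s ∈ Icc a b, f s = f a + ∫ r in a..s, φ r)
    (hg : ∀ s ∈ Icc a b, g s = g a + ∫ r in a..s, γ r) :
    B (f b) (g b) = B (f a) (g a) + ∫ r in a..b, (B (φ r) (g r) + B (f r) (γ r)) := by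
  have hcg : ContinuousOn (fun r => ∫ r' in a..r, γ r') (Icc a b) := by
    have := intervalIntegral.continuousOn_primitive_interval' hγ (left_mem_uIcc)
    rwa [uIcc_of_le hab] at this
  have hcf : ContinuousOn (fun r => ∫ r' in a..r, φ r') (Icc a b) := by
    have := intervalIntegral.continuousOn_primitive_interval' hφ (left_mem_uIcc)
    rwa [uIcc_of_le hab] at this
  have i1 := intervalIntegrable_bilin_left B hab hφ hcg
  have i2 := intervalIntegrable_bilin_left B.flip hab hγ hcf
  have i3 := intervalIntegrable_bilin_left B hab hφ (continuousOn_const (c := g a))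
  have i4 := intervalIntegrable_bilin_left B.flip hab hγ (continuousOn_const (c := f a))
  simp only [ContinuousLinearMap.flip_apply] at i2 i4
  -- Splitting off the constants `f a` and `g a` reduces the claim to primitives that vanish at `a`,
  -- plus terms that are linear in one primitive.
  have key : ∫ r in a..b, (B (φ r) (g r) + B (f r) (γ r)) =
      ∫ r in a..b, ((B (φ r) (∫ r' in a..r, γ r') + B (∫ r' in a..r, φ r') (γ r))
        + (B (φ r) (g a) + B (f a) (γ r))) := by
    refine intervalIntegral.integral_congr fun r hr => ?_
    rw [uIcc_of_le hab] at hr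
    simp only [hf r hr, hg r hr, map_add, add_apply]
    abel
  have h5 : ∫ r in a..b, B (φ r) (g a) = B (∫ r in a..b, φ r) (g a) :=
    (B.flip (g a)).intervalIntegral_comp_comm hφ
  have h6 : ∫ r in a..b, B (f a) (γ r) = B (f a) (∫ r in a..b, γ r) :=
    (B (f a)).intervalIntegral_comp_comm hγ
  rw [key, intervalIntegral.integral_add (i1.add i2) (i3.add i4),
    ← bilin_integral_integral B hab hφ hγ, intervalIntegral.integral_add i3 i4, h5, h6,
    hf b (right_mem_Icc.2 hab), hg b (right_mem_Icc.2 hab)]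
  simp only [map_add, add_apply]
  abel

end Primitives

/-! ### Volterra equations with a square integrable Lipschitz constant. -/

section Volterra

variable {E F : Type*} [NormedAddCommGroup E] [NormedSpace ℝ E] {a b : ℝ}

theorem intervalIntegrable_coeFn (hab : a ≤ b)
    (f : Lp E 1 ((volume : Measure ℝ).restrict (Ioc a b))) :
    IntervalIntegrable f volume a b :=
  (intervalIntegrable_iff_integrableOn_Ioc_of_le hab).2 (L1.integrable_coeFn f)

theorem intervalIntegrable_coeFn_sub (hab : a ≤ b) {f : ℝ → E} (hf : IntervalIntegrable f volume a b)
    {s : ℝ} (hs : s ∈ Icc a b) : IntervalIntegrable f volume a s :=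
  hf.mono_set (by rw [uIcc_of_le hs.1, uIcc_of_le hab]; exact Icc_subset_Icc_right hs.2)

theorem intervalIntegral_congr_ae_restrict {f g : ℝ → E}
    (h : f =ᵐ[(volume : Measure ℝ).restrict (Ioc a b)] g) {s : ℝ} (hs : s ∈ Icc a b) :
    ∫ r in a..s, f r = ∫ r in a..s, g r := by
  rw [intervalIntegral.integral_of_le hs.1, intervalIntegral.integral_of_le hs.1]
  exact integral_congr_ae (ae_restrict_of_ae_restrict_of_subset (Ioc_subset_Ioc_right hs.2) h)

variable (hab : a ≤ b)

theorem norm_iccExtend_le (X : C(Icc a b, E)) (r : ℝ) : ‖IccExtend hab X r‖ ≤ ‖X‖ :=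
  X.norm_coe_le_norm _

theorem continuous_iccExtend (X : C(Icc a b, E)) : Continuous (IccExtend hab X) :=
  X.continuous.Icc_extend'

/-- Continuous functions on `[a, b]` as elements of `Lᵖ(a, b)`. -/
def continuousToLp (p : ℝ≥0∞) [Fact (1 ≤ p)] :
    C(Icc a b, E) →L[ℝ] Lp E p ((volume : Measure ℝ).restrict (Ioc a b)) :=
  (BoundedContinuousFunction.toLp p ((volume : Measure ℝ).restrict (Ioc a b)) ℝ).comp
    (LinearMap.mkContinuous (σ := RingHom.id ℝ)
      { toFun := fun X : C(Icc a b, E) => BoundedContinuousFunction.ofNormedAddCommGroup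
          (IccExtend hab X) (continuous_iccExtend hab X) ‖X‖ (norm_iccExtend_le hab X)
        map_add' := fun X Y => by ext r; rfl
        map_smul' := fun c X => by ext r; rfl } 1
      (fun X => by
        rw [one_mul]
        exact BoundedContinuousFunction.norm_ofNormedAddCommGroup_le
          (continuous_iccExtend hab X) (norm_nonneg X) (norm_iccExtend_le hab X)))

theorem coeFn_continuousToLp (p : ℝ≥0∞) [Fact (1 ≤ p)] (X : C(Icc a b, E)) :
    continuousToLp hab p X =ᵐ[(volume : Measure ℝ).restrict (Ioc a b)] IccExtend hab X :=
  BoundedContinuousFunction.coeFn_toLp p _ ℝ (BoundedContinuousFunction.ofNormedAddCommGroup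
    (IccExtend hab X) (continuous_iccExtend hab X) ‖X‖ (norm_iccExtend_le hab X))

variable [CompleteSpace E]

/-- The primitive `s ↦ ∫_a^s f` of an integrable function, as a continuous function. -/
def primitive : Lp E 1 ((volume : Measure ℝ).restrict (Ioc a b)) →L[ℝ] C(Icc a b, E) :=
  LinearMap.mkContinuous
    { toFun := fun f => ⟨fun s => ∫ r in a..(s : ℝ), f r, by
        have := intervalIntegral.continuousOn_primitive_interval' (intervalIntegrable_coeFn hab f)
          left_mem_uIcc
        rw [uIcc_of_le hab] at this
        exact this.domRestrict⟩
      map_add' := fun f g => by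
        ext s
        change ∫ r in a..(s : ℝ), (f + g : Lp E 1 _) r = _
        rw [intervalIntegral_congr_ae_restrict (Lp.coeFn_add f g) s.2]
        exact intervalIntegral.integral_add
          (intervalIntegrable_coeFn_sub hab (intervalIntegrable_coeFn hab f) s.2)
          (intervalIntegrable_coeFn_sub hab (intervalIntegrable_coeFn hab g) s.2)
      map_smul' := fun c f => by
        ext s
        change ∫ r in a..(s : ℝ), (c • f : Lp E 1 _) r = _
        rw [intervalIntegral_congr_ae_restrict (Lp.coeFn_smul c f) s.2]
        exact intervalIntegral.integral_smul c f } 1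
    (fun f => by
      rw [one_mul]
      refine (ContinuousMap.norm_le _ (norm_nonneg _)).2 fun s => ?_
      rw [L1.norm_eq_integral_norm]
      change ‖∫ r in a..(s : ℝ), f r‖ ≤ _
      rw [intervalIntegral.integral_of_le s.2.1]
      refine (norm_integral_le_integral_norm _).trans ?_
      exact setIntegral_mono_set (L1.integrable_coeFn f).norm
        (Filter.Eventually.of_forall fun _ => norm_nonneg _)
        (Ioc_subset_Ioc_right s.2.2).eventuallyLE)

theorem primitive_apply (f : Lp E 1 ((volume : Measure ℝ).restrict (Ioc a b))) (s : Icc a b) :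
    primitive hab f s = ∫ r in a..(s : ℝ), f r := rfl

/-- This is the gain from the exponential weight: the bound tends to zero as `lam` grows, whatever
the length of the interval. -/
theorem integral_exp_decay_le {lam s : ℝ} (hlam : 0 < lam) :
    ∫ r in a..s, Real.exp (-(2 * lam * (s - r))) ≤ 1 / (2 * lam) := by
  have hd : ∀ r ∈ uIcc a s, HasDerivAt (fun r => Real.exp (-(2 * lam * (s - r))) / (2 * lam))
      (Real.exp (-(2 * lam * (s - r)))) r := by
    intro r _
    have h1 : HasDerivAt (fun r => -(2 * lam * (s - r))) (2 * lam) r := by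
      have h2 := (((hasDerivAt_id r).const_sub s).const_mul (2 * lam)).neg
      exact h2.congr_deriv (by ring)
    refine ((h1.exp).div_const (2 * lam)).congr_deriv ?_
    rw [mul_div_assoc, div_self (by positivity), mul_one]
  rw [intervalIntegral.integral_eq_sub_of_hasDerivAt hd
    (Continuous.intervalIntegrable (by fun_prop) _ _)]
  simp only [sub_self, mul_zero, neg_zero, Real.exp_zero]
  have : 0 ≤ Real.exp (-(2 * lam * (s - a))) / (2 * lam) := by positivity
  linarith

/-- Multiplication of a continuous function by the exponential weight `e^{lam s}`. -/
def expWeight (lam : ℝ) (Z : C(Icc a b, E)) : C(Icc a b, E) :=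
  ⟨fun s => Real.exp (lam * (s : ℝ)) • Z s, by fun_prop⟩

theorem expWeight_expWeight (lam : ℝ) (Z : C(Icc a b, E)) :
    expWeight lam (expWeight (-lam) Z) = Z := by
  ext s
  change Real.exp _ • Real.exp _ • Z s = Z s
  rw [smul_smul, ← Real.exp_add]
  simp

/-- Existence and uniqueness for Volterra equations `X(s) = c(s) + ∫_a^s N(X)(r) dr` whose right-hand
side is Lipschitz with a square integrable constant. -/
theorem existsUnique_volterra
    (N : C(Icc a b, E) → Lp E 1 ((volume : Measure ℝ).restrict (Ioc a b))) {ℓ : ℝ → ℝ}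
    (hℓ : IntervalIntegrable (fun r => ℓ r ^ 2) volume a b)
    (hN : ∀ X Y, ∀ᵐ r ∂(volume : Measure ℝ).restrict (Ioc a b),
      ‖N X r - N Y r‖ ≤ ℓ r * ‖IccExtend hab X r - IccExtend hab Y r‖) (c : C(Icc a b, E)) :
    ∃! X, X = c + primitive hab (N X) := by
  set L := ∫ r in a..b, ℓ r ^ 2 with hL
  have hL0 : 0 ≤ L := intervalIntegral.integral_nonneg hab fun r _ => sq_nonneg _
  -- Young's inequality `ℓe ≤ ℓ²/(4(L+1)) + (L+1)e²` splits the contraction constant in two: the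
  -- first term integrates to at most `1/4`, and the second to at most `(L+1)/(2 lam) = 1/4`. Taking
  -- `L + 1` instead of `L` avoids dividing by zero.
  set lam := 2 * (L + 1) with hlam
  have hlam0 : 0 < lam := by positivity
  -- The Picard map conjugated by the weight `e^{lam s}`. Contraction in the supremum norm for `T`
  -- is contraction in a weighted norm for the original map, so no subdivision of the interval is
  -- needed.
  set T : C(Icc a b, E) → C(Icc a b, E) := fun Z =>
    expWeight (-lam) (c + primitive hab (N (expWeight lam Z))) with hT
  have hcontr : ContractingWith (1 / 2) T := by
    refine ⟨by rw [← NNReal.coe_lt_coe]; norm_num, LipschitzWith.of_dist_le_mul fun Z₁ Z₂ => ?_⟩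
    rw [dist_eq_norm, dist_eq_norm]
    refine (ContinuousMap.norm_le _ (by positivity)).2 fun s => ?_
    have hs := s.2
    have e1 : (T Z₁ - T Z₂) s = Real.exp (-lam * s) •
        ∫ r in a..(s : ℝ), (N (expWeight lam Z₁) r - N (expWeight lam Z₂) r) := by
      rw [intervalIntegral.integral_sub
        (intervalIntegrable_coeFn_sub hab (intervalIntegrable_coeFn hab _) hs)
        (intervalIntegrable_coeFn_sub hab (intervalIntegrable_coeFn hab _) hs),
        ← primitive_apply hab, ← primitive_apply hab]
      change Real.exp (-lam * s) • (c s + _) - Real.exp (-lam * s) • (c s + _) = _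
      rw [← smul_sub, add_sub_add_left_eq_sub]
    have hint2 : IntervalIntegrable (fun r => 1 / (4 * (L + 1)) * ℓ r ^ 2
        + (L + 1) * Real.exp (-(2 * lam * (s - r)))) volume a s :=
      ((intervalIntegrable_coeFn_sub hab hℓ hs).const_mul _).add
        (Continuous.intervalIntegrable (by fun_prop) _ _)
    have e2 : ‖∫ r in a..(s : ℝ), (N (expWeight lam Z₁) r - N (expWeight lam Z₂) r)‖ ≤
        ∫ r in a..(s : ℝ), Real.exp (lam * s) * ‖Z₁ - Z₂‖ * (1 / (4 * (L + 1)) * ℓ r ^ 2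
        + (L + 1) * Real.exp (-(2 * lam * (s - r)))) := by
      refine intervalIntegral.norm_integral_le_of_norm_le hs.1 ?_ (hint2.const_mul _)
      have h3 := hN (expWeight lam Z₁) (expWeight lam Z₂)
      rw [ae_restrict_iff' measurableSet_Ioc] at h3
      filter_upwards [h3] with r hr hrs
      have hrab : r ∈ Ioc a b := ⟨hrs.1, hrs.2.trans hs.2⟩
      refine (hr hrab).trans ?_
      have h4 : ‖IccExtend hab (expWeight lam Z₁) r - IccExtend hab (expWeight lam Z₂) r‖ =
          Real.exp (lam * r) * ‖IccExtend hab (Z₁ - Z₂) r‖ := by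
        rw [IccExtend_of_mem hab _ (Ioc_subset_Icc_self hrab),
          IccExtend_of_mem hab _ (Ioc_subset_Icc_self hrab),
          IccExtend_of_mem hab _ (Ioc_subset_Icc_self hrab)]
        change ‖Real.exp (lam * r) • Z₁ _ - Real.exp (lam * r) • Z₂ _‖ = _
        rw [← smul_sub, norm_smul, Real.norm_eq_abs, abs_of_pos (Real.exp_pos _)]
        rfl
      have h5 := norm_iccExtend_le hab (Z₁ - Z₂) r
      have h6 : Real.exp (lam * r) = Real.exp (lam * s) * Real.exp (-(lam * (s - r))) := by
        rw [← Real.exp_add]; ring_nf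
      have h7 : Real.exp (-(2 * lam * (s - r))) = Real.exp (-(lam * (s - r))) ^ 2 := by
        rw [← Real.exp_nat_mul]; ring_nf
      rw [h4, h7, h6]
      set e := Real.exp (-(lam * (s - r)))
      set M := Real.exp (lam * s)
      have h8 : ℓ r * e ≤ 1 / (4 * (L + 1)) * ℓ r ^ 2 + (L + 1) * e ^ 2 := by
        have : 0 ≤ (ℓ r - 2 * (L + 1) * e) ^ 2 / (4 * (L + 1)) := by positivity
        have h9 : (ℓ r - 2 * (L + 1) * e) ^ 2 / (4 * (L + 1)) =
          1 / (4 * (L + 1)) * ℓ r ^ 2 + (L + 1) * e ^ 2 - ℓ r * e := by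
          field_simp
          ring
        linarith
      have h10 : 0 ≤ 1 / (4 * (L + 1)) * ℓ r ^ 2 + (L + 1) * e ^ 2 := by positivity
      calc ℓ r * (M * e * ‖IccExtend hab (Z₁ - Z₂) r‖)
          = M * ‖IccExtend hab (Z₁ - Z₂) r‖ * (ℓ r * e) := by ring
        _ ≤ M * ‖IccExtend hab (Z₁ - Z₂) r‖ * (1 / (4 * (L + 1)) * ℓ r ^ 2 + (L + 1) * e ^ 2) := by
          gcongr
        _ ≤ _ := by gcongr
    have e3 : ∫ r in a..(s : ℝ), (1 / (4 * (L + 1)) * ℓ r ^ 2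
        + (L + 1) * Real.exp (-(2 * lam * (s - r)))) ≤ 1 / 2 := by
      rw [intervalIntegral.integral_add ((intervalIntegrable_coeFn_sub hab hℓ hs).const_mul _)
        (Continuous.intervalIntegrable (by fun_prop) _ _), intervalIntegral.integral_const_mul,
        intervalIntegral.integral_const_mul]
      have h1 : ∫ r in a..(s : ℝ), ℓ r ^ 2 ≤ L :=
        intervalIntegral.integral_mono_interval le_rfl hs.1 hs.2
          (Filter.Eventually.of_forall fun _ => sq_nonneg _) hℓ
      have h2 := integral_exp_decay_le (a := a) (s := s) hlam0
      calc _ ≤ 1 / (4 * (L + 1)) * L + (L + 1) * (1 / (2 * lam)) := by gcongr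
        _ ≤ _ := by
          rw [hlam]
          have : 1 / (4 * (L + 1)) * L ≤ 1 / 4 := by
            rw [div_mul_eq_mul_div, div_le_div_iff₀ (by positivity) (by norm_num)]
            linarith
          have : (L + 1) * (1 / (2 * (2 * (L + 1)))) = 1 / 4 := by field_simp; norm_num
          linarith
    rw [e1, norm_smul, Real.norm_eq_abs, abs_of_pos (Real.exp_pos _)]
    rw [intervalIntegral.integral_const_mul] at e2
    calc Real.exp (-lam * s) * _ ≤ Real.exp (-lam * s) * (Real.exp (lam * s) * ‖Z₁ - Z₂‖ *
          (1 / 2)) := by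
          gcongr
          exact e2.trans (by gcongr)
      _ = (Real.exp (-lam * s) * Real.exp (lam * s)) * ((1 / 2) * ‖Z₁ - Z₂‖) := by ring
      _ = _ := by
        rw [← Real.exp_add]
        simp
  have hfix : ∀ X : C(Icc a b, E), X = c + primitive hab (N X) ↔
      Function.IsFixedPt T (expWeight (-lam) X) := by
    intro X
    have h1 := expWeight_expWeight lam X
    constructor
    · intro h
      change expWeight (-lam) (c + primitive hab (N (expWeight lam (expWeight (-lam) X)))) = _
      rw [h1, ← h]
    · intro h
      change expWeight (-lam) (c + primitive hab (N (expWeight lam (expWeight (-lam) X)))) = _ at h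
      rw [h1] at h
      have h2 := congrArg (expWeight lam) h
      rw [expWeight_expWeight, expWeight_expWeight] at h2
      exact h2.symm
  refine ⟨expWeight lam (ContractingWith.fixedPoint T hcontr), (hfix _).2 ?_, fun Y hY => ?_⟩
  · have := expWeight_expWeight (-lam) (ContractingWith.fixedPoint T hcontr)
    rw [neg_neg] at this
    rw [this]
    exact hcontr.fixedPoint_isFixedPt
  · have := hcontr.fixedPoint_unique ((hfix Y).1 hY)
    rw [← this, expWeight_expWeight]

end Volterra

/-! ### Products of continuous and square integrable functions. -/

section LpProducts

variable {E V W Z : Type*} [NormedAddCommGroup E] [NormedSpace ℝ E] [NormedAddCommGroup V]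
  [NormedSpace ℝ V] [NormedAddCommGroup W] [NormedSpace ℝ W] [NormedAddCommGroup Z]
  [NormedSpace ℝ Z] {a b : ℝ} (hab : a ≤ b)

/-- The product `C([a, b]) × L² → L¹` induced by a bounded bilinear map. -/
def mulL1 (β : V →L[ℝ] W →L[ℝ] Z) :
    C(Icc a b, V) →L[ℝ] Lp W 2 ((volume : Measure ℝ).restrict (Ioc a b)) →L[ℝ]
      Lp Z 1 ((volume : Measure ℝ).restrict (Ioc a b)) :=
  (β.holderL _ 2 2 1).comp (continuousToLp hab 2)

theorem coeFn_mulL1 (β : V →L[ℝ] W →L[ℝ] Z) (X : C(Icc a b, V))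
    (u : Lp W 2 ((volume : Measure ℝ).restrict (Ioc a b))) :
    mulL1 hab β X u =ᵐ[(volume : Measure ℝ).restrict (Ioc a b)]
      fun r => β (IccExtend hab X r) (u r) := by
  have h := β.coeFn_holder (r := 1) (continuousToLp hab 2 X) u
  filter_upwards [h, coeFn_continuousToLp hab 2 X] with r h1 h2
  rw [← h2]
  exact h1

/-- The product `C([a, b]) × L² → L²` induced by a bounded bilinear map. -/
def mulL2 (β : V →L[ℝ] W →L[ℝ] Z) :
    C(Icc a b, V) →L[ℝ] Lp W 2 ((volume : Measure ℝ).restrict (Ioc a b)) →L[ℝ]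
      Lp Z 2 ((volume : Measure ℝ).restrict (Ioc a b)) :=
  (β.holderL _ ∞ 2 2).comp (continuousToLp hab ∞)

theorem coeFn_mulL2 (β : V →L[ℝ] W →L[ℝ] Z) (X : C(Icc a b, V))
    (u : Lp W 2 ((volume : Measure ℝ).restrict (Ioc a b))) :
    mulL2 hab β X u =ᵐ[(volume : Measure ℝ).restrict (Ioc a b)]
      fun r => β (IccExtend hab X r) (u r) := by
  have h := β.coeFn_holder (r := 2) (continuousToLp hab ∞ X) u
  filter_upwards [h, coeFn_continuousToLp hab ∞ X] with r h1 h2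
  rw [← h2]
  exact h1

theorem intervalIntegrable_norm_sq (hab : a ≤ b)
    (u : Lp V 2 ((volume : Measure ℝ).restrict (Ioc a b))) :
    IntervalIntegrable (fun r => ‖u r‖ ^ 2) volume a b := by
  rw [intervalIntegrable_iff_integrableOn_Ioc_of_le hab]
  exact (memLp_two_iff_integrable_sq_norm (Lp.memLp u).1).1 (Lp.memLp u)

theorem intervalIntegrable_norm (hab : a ≤ b)
    (u : Lp V 2 ((volume : Measure ℝ).restrict (Ioc a b))) :
    IntervalIntegrable (fun r => ‖u r‖) volume a b := by
  rw [intervalIntegrable_iff_integrableOn_Ioc_of_le hab]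
  exact ((Lp.memLp u).integrable one_le_two).norm

theorem intervalIntegrable_affine_norm_sq (hab : a ≤ b) (α β : ℝ)
    (u : Lp V 2 ((volume : Measure ℝ).restrict (Ioc a b))) :
    IntervalIntegrable (fun r => (α + β * ‖u r‖) ^ 2) volume a b := by
  have h : (fun r => (α + β * ‖u r‖) ^ 2) =
      fun r => α ^ 2 + (2 * α * β) * ‖u r‖ + β ^ 2 * ‖u r‖ ^ 2 := by
    ext r; ring
  rw [h]
  exact ((intervalIntegrable_const (c := α ^ 2)).add
    ((intervalIntegrable_norm hab u).const_mul _)).add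
    ((intervalIntegrable_norm_sq hab u).const_mul _)

end LpProducts

/-! ### The control-to-state map and its smoothness. -/

section StateEquation

variable {E V : Type*} [NormedAddCommGroup E] [NormedSpace ℝ E] [CompleteSpace E]
  [NormedAddCommGroup V] [NormedSpace ℝ V] {a b : ℝ} (hab : a ≤ b)
  (A : C2Coeff (Icc a b) E E) (B : C2Coeff (Icc a b) E (V →L[ℝ] E))

/-- The right-hand side `A(s, X) + B(s, X) u` of the state equation, as an integrable function. -/
def stateRate (X : C(Icc a b, E)) (u : Lp V 2 ((volume : Measure ℝ).restrict (Ioc a b))) :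
    Lp E 1 ((volume : Measure ℝ).restrict (Ioc a b)) :=
  continuousToLp hab 1 (superpose A.f₀ X)
    + mulL1 hab (ContinuousLinearMap.id ℝ (V →L[ℝ] E)) (superpose B.f₀ X) u

theorem coeFn_stateRate (X : C(Icc a b, E))
    (u : Lp V 2 ((volume : Measure ℝ).restrict (Ioc a b))) :
    stateRate hab A B X u =ᵐ[(volume : Measure ℝ).restrict (Ioc a b)]
      fun r => IccExtend hab (superpose A.f₀ X) r + IccExtend hab (superpose B.f₀ X) r (u r) := by
  filter_upwards [Lp.coeFn_add (continuousToLp hab 1 (superpose A.f₀ X))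
      (mulL1 hab (ContinuousLinearMap.id ℝ (V →L[ℝ] E)) (superpose B.f₀ X) u),
    coeFn_continuousToLp hab 1 (superpose A.f₀ X),
    coeFn_mulL1 hab (ContinuousLinearMap.id ℝ (V →L[ℝ] E)) (superpose B.f₀ X) u] with r h1 h2 h3
  rw [stateRate, h1, Pi.add_apply, h2, h3]
  rfl

/-- The derivative of the right-hand side of the state equation with respect to the state. -/
def linearRate (X : C(Icc a b, E)) (u : Lp V 2 ((volume : Measure ℝ).restrict (Ioc a b))) :
    C(Icc a b, E) →L[ℝ] Lp E 1 ((volume : Measure ℝ).restrict (Ioc a b)) :=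
  (continuousToLp hab 1).comp (pointwiseApply (superpose A.f₁ X))
    + ((mulL1 hab (ContinuousLinearMap.id ℝ (V →L[ℝ] E))).flip u).comp
      (pointwiseApply (superpose B.f₁ X))

theorem coeFn_linearRate (X : C(Icc a b, E))
    (u : Lp V 2 ((volume : Measure ℝ).restrict (Ioc a b))) (h : C(Icc a b, E)) :
    linearRate hab A B X u h =ᵐ[(volume : Measure ℝ).restrict (Ioc a b)]
      fun r => IccExtend hab (superpose A.f₁ X) r (IccExtend hab h r)
        + IccExtend hab (superpose B.f₁ X) r (IccExtend hab h r) (u r) := by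
  filter_upwards [Lp.coeFn_add (continuousToLp hab 1 (pointwiseApply (superpose A.f₁ X) h))
      (mulL1 hab (ContinuousLinearMap.id ℝ (V →L[ℝ] E)) (pointwiseApply (superpose B.f₁ X) h) u),
    coeFn_continuousToLp hab 1 (pointwiseApply (superpose A.f₁ X) h),
    coeFn_mulL1 hab (ContinuousLinearMap.id ℝ (V →L[ℝ] E)) (pointwiseApply (superpose B.f₁ X) h) u]
    with r h1 h2 h3
  change (continuousToLp hab 1 (pointwiseApply (superpose A.f₁ X) h)
      + mulL1 hab (ContinuousLinearMap.id ℝ (V →L[ℝ] E)) (pointwiseApply (superpose B.f₁ X) h) u :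
        Lp E 1 _) r = _
  rw [h1, Pi.add_apply, h2, h3]
  rfl

theorem exists_norm_le {K : Type*} [TopologicalSpace K] [CompactSpace K] (X : C(K, E)) :
    ∃ κ, ∀ s, ‖X s‖ ≤ κ :=
  ⟨‖X‖, X.norm_coe_le_norm⟩

/-- The derivatives `f₁` are bounded along `X` by compactness, which gives the Lipschitz constant
`κ₁ + κ₂‖u r‖`. The result says that the linearized state equation is solvable for every `c`, as the
implicit function theorem requires. -/
theorem existsUnique_linear (X : C(Icc a b, E))
    (u : Lp V 2 ((volume : Measure ℝ).restrict (Ioc a b))) (c : C(Icc a b, E)) :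
    ∃! h, h = c + primitive hab (linearRate hab A B X u h) := by
  obtain ⟨κ₁, hκ₁⟩ := exists_norm_le (superpose A.f₁ X)
  obtain ⟨κ₂, hκ₂⟩ := exists_norm_le (superpose B.f₁ X)
  refine existsUnique_volterra hab (fun h => linearRate hab A B X u h)
    (intervalIntegrable_affine_norm_sq hab κ₁ κ₂ u) ?_ c
  intro h k
  filter_upwards [coeFn_linearRate hab A B X u h, coeFn_linearRate hab A B X u k] with r h1 h2
  have h3 : ‖(A.f₁ (projIcc a b hab r, X (projIcc a b hab r)))
      (IccExtend hab h r - IccExtend hab k r)‖ ≤ κ₁ * ‖IccExtend hab h r - IccExtend hab k r‖ :=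
    ContinuousLinearMap.le_of_opNorm_le _ (hκ₁ (projIcc a b hab r)) _
  have h4 : ‖(B.f₁ (projIcc a b hab r, X (projIcc a b hab r)))
      (IccExtend hab h r - IccExtend hab k r)‖ ≤ κ₂ * ‖IccExtend hab h r - IccExtend hab k r‖ :=
    ContinuousLinearMap.le_of_opNorm_le _ (hκ₂ (projIcc a b hab r)) _
  have h5 := ContinuousLinearMap.le_of_opNorm_le _ h4 (u r)
  have h6 : linearRate hab A B X u h r - linearRate hab A B X u k r =
      (A.f₁ (projIcc a b hab r, X (projIcc a b hab r))) (IccExtend hab h r - IccExtend hab k r) +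
      (B.f₁ (projIcc a b hab r, X (projIcc a b hab r)))
        (IccExtend hab h r - IccExtend hab k r) (u r) := by
    rw [h1, h2, map_sub, map_sub, sub_apply, ← add_sub_add_comm]
    rfl
  rw [h6]
  refine (norm_add_le _ _).trans ((add_le_add h3 h5).trans (le_of_eq (by ring)))

/-- Global Lipschitz continuity of the coefficients of the state equation. -/
def LipschitzCoeffs : Prop :=
  ∃ κ₁ κ₂ : ℝ, ∀ s x y, ‖A.f₀ (s, x) - A.f₀ (s, y)‖ ≤ κ₁ * ‖x - y‖ ∧
    ‖B.f₀ (s, x) - B.f₀ (s, y)‖ ≤ κ₂ * ‖x - y‖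

variable {A B}

theorem existsUnique_state (hL : LipschitzCoeffs A B) (x : E)
    (u : Lp V 2 ((volume : Measure ℝ).restrict (Ioc a b))) :
    ∃! X, X = ContinuousMap.const _ x + primitive hab (stateRate hab A B X u) := by
  obtain ⟨κ₁, κ₂, hκ⟩ := hL
  refine existsUnique_volterra hab (fun X => stateRate hab A B X u)
    (intervalIntegrable_affine_norm_sq hab κ₁ κ₂ u) ?_ _
  intro X Y
  filter_upwards [coeFn_stateRate hab A B X u, coeFn_stateRate hab A B Y u] with r h1 h2
  rw [h1, h2, add_sub_add_comm, ← sub_apply, add_mul]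
  refine (norm_add_le _ _).trans (add_le_add (hκ _ _ _).1 ?_)
  refine (ContinuousLinearMap.le_opNorm _ _).trans ?_
  rw [mul_right_comm]
  gcongr
  exact (hκ _ _ _).2

/-- The control-to-state map. -/
def stateMap (hL : LipschitzCoeffs A B) (x : E)
    (u : Lp V 2 ((volume : Measure ℝ).restrict (Ioc a b))) : C(Icc a b, E) :=
  (existsUnique_state hab hL x u).choose

theorem stateMap_eq (hL : LipschitzCoeffs A B) (x : E)
    (u : Lp V 2 ((volume : Measure ℝ).restrict (Ioc a b))) :
    stateMap hab hL x u = ContinuousMap.const _ x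
      + primitive hab (stateRate hab A B (stateMap hab hL x u) u) :=
  (existsUnique_state hab hL x u).choose_spec.1

theorem eq_stateMap (hL : LipschitzCoeffs A B) (x : E)
    {u : Lp V 2 ((volume : Measure ℝ).restrict (Ioc a b))} {X : C(Icc a b, E)}
    (hX : X = ContinuousMap.const _ x + primitive hab (stateRate hab A B X u)) :
    X = stateMap hab hL x u :=
  (existsUnique_state hab hL x u).choose_spec.2 X hX

variable (A B)

theorem contDiff_stateRate :
    ContDiff ℝ 2 fun p : Lp V 2 ((volume : Measure ℝ).restrict (Ioc a b)) × C(Icc a b, E) =>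
      stateRate hab A B p.2 p.1 := by
  have h1 : ContDiff ℝ 2 fun p : Lp V 2 ((volume : Measure ℝ).restrict (Ioc a b)) × C(Icc a b, E) =>
      superpose A.f₀ p.2 := A.contDiff.comp contDiff_snd
  have h2 : ContDiff ℝ 2 fun p : Lp V 2 ((volume : Measure ℝ).restrict (Ioc a b)) × C(Icc a b, E) =>
      superpose B.f₀ p.2 := B.contDiff.comp contDiff_snd
  have h3 := (mulL1 hab (ContinuousLinearMap.id ℝ (V →L[ℝ] E))).contDiff.comp h2
  exact ((continuousToLp hab 1).contDiff.comp h1).add (h3.clm_apply contDiff_fst)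

theorem hasFDerivAt_stateRate (X : C(Icc a b, E))
    (u : Lp V 2 ((volume : Measure ℝ).restrict (Ioc a b))) :
    HasFDerivAt (fun X => stateRate hab A B X u) (linearRate hab A B X u) X := by
  have h1 := hasFDerivAt_superpose A.f₀ A.f₁ A.hasFDerivAt₀ X
  have h2 := hasFDerivAt_superpose B.f₀ B.f₁ B.hasFDerivAt₀ X
  have h3 := (continuousToLp hab 1 :
    C(Icc a b, E) →L[ℝ] Lp E 1 ((volume : Measure ℝ).restrict (Ioc a b))).hasFDerivAt.comp X h1
  have h4 := ((mulL1 hab (ContinuousLinearMap.id ℝ (V →L[ℝ] E))).flip u).hasFDerivAt.comp X h2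
  exact h3.add h4

variable {A B}

/-- Near `u` the state map is the implicit function of the C² equation `F (u, X) = 0`. -/
theorem contDiff_stateMap [CompleteSpace V] (hL : LipschitzCoeffs A B) (x : E) :
    ContDiff ℝ 2 (stateMap hab hL x) := by
  rw [contDiff_iff_contDiffAt]
  intro u
  set F : Lp V 2 ((volume : Measure ℝ).restrict (Ioc a b)) × C(Icc a b, E) → C(Icc a b, E) :=
    fun p => p.2 - (ContinuousMap.const _ x + primitive hab (stateRate hab A B p.2 p.1)) with hF
  have hcd : ContDiff ℝ 2 F := by
    have h1 := (primitive (E := E) hab).contDiff.comp (contDiff_stateRate hab A B)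
    exact contDiff_snd.sub (contDiff_const.add h1)
  set p₀ := (u, stateMap hab hL x u) with hp₀
  have hF0 : F p₀ = 0 := sub_eq_zero.2 (stateMap_eq hab hL x u)
  set D : C(Icc a b, E) →L[ℝ] C(Icc a b, E) := ContinuousLinearMap.id ℝ _
    - (primitive hab).comp (linearRate hab A B (stateMap hab hL x u) u) with hD
  -- The partial derivative is computed directly with `u` frozen and identified by uniqueness of
  -- derivatives.
  have hpartial : fderiv ℝ F p₀ ∘L .inr ℝ _ _ = D := by
    have h1 : HasFDerivAt (fun X => F (u, X)) (fderiv ℝ F p₀ ∘L .inr ℝ _ _)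
        (stateMap hab hL x u) :=
      (hcd.differentiable (by norm_num) p₀).hasFDerivAt.comp (stateMap hab hL x u)
        (hasFDerivAt_prodMk_right u (stateMap hab hL x u))
    have h2 : HasFDerivAt (fun X => F (u, X)) D (stateMap hab hL x u) := by
      have h3 := (primitive hab).hasFDerivAt.comp (stateMap hab hL x u)
        (hasFDerivAt_stateRate hab A B (stateMap hab hL x u) u)
      exact (hasFDerivAt_id _).sub (h3.const_add _)
    exact h1.unique h2
  have hDe : ∀ h c, D h = c ↔ h = c + primitive hab (linearRate hab A B (stateMap hab hL x u) u h) :=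
    fun h c => sub_eq_iff_eq_add
  have hbij : Function.Bijective D := by
    refine ⟨fun h k hhk => ?_, fun c => ?_⟩
    · exact (existsUnique_linear hab A B (stateMap hab hL x u) u (D k)).unique
        ((hDe h _).1 hhk) ((hDe k _).1 rfl)
    · obtain ⟨h, hh, -⟩ := existsUnique_linear hab A B (stateMap hab hL x u) u c
      exact ⟨h, (hDe h c).2 hh⟩
  have hinv : (fderiv ℝ F p₀ ∘L .inr ℝ _ _).IsInvertible := by
    rw [hpartial]
    -- The inverse is bounded by the open mapping theorem.
    exact ⟨ContinuousLinearEquiv.ofBijective D (LinearMap.ker_eq_bot.2 hbij.1)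
      (LinearMap.range_eq_top.2 hbij.2), rfl⟩
  have hcda : ContDiffAt ℝ 2 F p₀ := hcd.contDiffAt
  have hev := hcda.eventually_apply_implicitFunction (by norm_num) hinv
  have hsm := hcda.contDiffAt_implicitFunction (by norm_num) hinv
  -- The implicit function solves the state equation for nearby controls, so uniqueness of the state
  -- identifies it with `stateMap`.
  refine hsm.congr_of_eventuallyEq ?_
  filter_upwards [hev] with w hw
  rw [hF0] at hw
  exact (eq_stateMap hab hL x (sub_eq_zero.1 hw)).symm

end StateEquation

/-! ### Second variations of the state and of the cost in function spaces. -/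

section SecondVariation

theorem Lp_coeFn_add_ae_eq {Z : Type*} [NormedAddCommGroup Z] {μ : Measure ℝ} {p : ℝ≥0∞}
    {f g : Lp Z p μ} {φ γ : ℝ → Z} (hf : f =ᵐ[μ] φ) (hg : g =ᵐ[μ] γ) :
    (f + g : Lp Z p μ) =ᵐ[μ] fun r => φ r + γ r :=
  (Lp.coeFn_add f g).trans (hf.add hg)

theorem Lp_coeFn_smul_ae_eq {Z : Type*} [NormedAddCommGroup Z] [NormedSpace ℝ Z] {μ : Measure ℝ}
    {p : ℝ≥0∞} (c : ℝ) {f : Lp Z p μ} {φ : ℝ → Z} (hf : f =ᵐ[μ] φ) :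
    (c • f : Lp Z p μ) =ᵐ[μ] fun r => c • φ r :=
  (Lp.coeFn_smul c f).trans (hf.const_smul c)

variable {E V : Type*} [NormedAddCommGroup E] [NormedSpace ℝ E] [CompleteSpace E]
  [NormedAddCommGroup V] [InnerProductSpace ℝ V] {a b : ℝ} (hab : a ≤ b)
  (A : C2Coeff (Icc a b) E E) (B : C2Coeff (Icc a b) E (V →L[ℝ] E))

/-- The second variation of the right-hand side of the state equation, without the term that
contains the second variation of the state. -/
def stateRate₂ (X : C(Icc a b, E)) (u : Lp V 2 ((volume : Measure ℝ).restrict (Ioc a b)))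
    (h : C(Icc a b, E)) (v : Lp V 2 ((volume : Measure ℝ).restrict (Ioc a b))) :
    Lp E 1 ((volume : Measure ℝ).restrict (Ioc a b)) :=
  continuousToLp hab 1 (pointwiseApply (pointwiseApply (superpose A.f₂ X) h) h)
    + (mulL1 hab (ContinuousLinearMap.id ℝ (V →L[ℝ] E))
        (pointwiseApply (pointwiseApply (superpose B.f₂ X) h) h) u
      + (2 : ℝ) • mulL1 hab (ContinuousLinearMap.id ℝ (V →L[ℝ] E))
        (pointwiseApply (superpose B.f₁ X) h) v)

theorem coeFn_stateRate₂ (X : C(Icc a b, E))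
    (u : Lp V 2 ((volume : Measure ℝ).restrict (Ioc a b))) (h : C(Icc a b, E))
    (v : Lp V 2 ((volume : Measure ℝ).restrict (Ioc a b))) :
    stateRate₂ hab A B X u h v =ᵐ[(volume : Measure ℝ).restrict (Ioc a b)] fun r =>
      A.f₂ (projIcc a b hab r, X (projIcc a b hab r)) (h (projIcc a b hab r))
          (h (projIcc a b hab r))
        + (B.f₂ (projIcc a b hab r, X (projIcc a b hab r)) (h (projIcc a b hab r))
            (h (projIcc a b hab r)) (u r)
          + (2 : ℝ) • B.f₁ (projIcc a b hab r, X (projIcc a b hab r)) (h (projIcc a b hab r))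
            (v r)) :=
  Lp_coeFn_add_ae_eq (coeFn_continuousToLp hab 1 _) (Lp_coeFn_add_ae_eq (coeFn_mulL1 hab _ _ u)
    (Lp_coeFn_smul_ae_eq 2 (coeFn_mulL1 hab _ _ v)))

variable {A B}

/-- The jet exists because the state map is C². Differentiating the integral equation along the line
gives a second expression for the same jet, and comparison yields the two variational equations. -/
theorem stateMap_hasJet2 [CompleteSpace V] (hL : LipschitzCoeffs A B) (x : E)
    (u v : Lp V 2 ((volume : Measure ℝ).restrict (Ioc a b))) :
    ∃ X₁ X₂ : C(Icc a b, E), HasJet2 (fun ε : ℝ => stateMap hab hL x (u + ε • v)) X₁ X₂ ∧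
      X₁ = primitive hab (linearRate hab A B (stateMap hab hL x u) u X₁
        + mulL1 hab (ContinuousLinearMap.id ℝ (V →L[ℝ] E))
          (superpose B.f₀ (stateMap hab hL x u)) v) ∧
      X₂ = primitive hab (linearRate hab A B (stateMap hab hL x u) u X₂
        + stateRate₂ hab A B (stateMap hab hL x u) u X₁ v) := by
  have h0 : u + (0 : ℝ) • v = u := by simp
  have hj := (HasJet2.line u v).comp_contDiff (contDiff_stateMap hab hL x)
  refine ⟨_, _, hj, ?_⟩
  -- From here on only the jet property matters, not the form of the derivatives.
  generalize fderiv ℝ (stateMap hab hL x) (u + (0 : ℝ) • v) v = X₁ at hj ⊢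
  generalize fderiv ℝ (fderiv ℝ (stateMap hab hL x)) (u + (0 : ℝ) • v) v v
    + fderiv ℝ (stateMap hab hL x) (u + (0 : ℝ) • v) 0 = X₂ at hj ⊢
  have hA := (hj.superposition A).clm (continuousToLp hab 1)
  have hB := HasJet2.bilin (mulL1 hab (ContinuousLinearMap.id ℝ (V →L[ℝ] E)))
    (hj.superposition B) (HasJet2.line u v)
  have hR := (HasJet2.const (ContinuousMap.const (Icc a b) x)).add ((hA.add hB).clm (primitive hab))
  have heq : (fun ε : ℝ => stateMap hab hL x (u + ε • v)) = fun ε : ℝ =>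
      ContinuousMap.const (Icc a b) x + primitive hab (stateRate hab A B
        (stateMap hab hL x (u + ε • v)) (u + ε • v)) :=
    funext fun ε => stateMap_eq hab hL x _
  rw [heq] at hj
  have hu := hj.unique hR
  simp only [h0, zero_add, map_zero, add_zero] at hu
  obtain ⟨h1, h2⟩ := hu
  refine ⟨h1.trans (congrArg (primitive hab) (add_assoc _ _ _).symm),
    h2.trans (congrArg (primitive hab) ?_)⟩
  rw [map_add, map_add, add_apply]
  change _ = (continuousToLp hab 1 (pointwiseApply (superpose A.f₁ _) X₂)
    + mulL1 hab (ContinuousLinearMap.id ℝ (V →L[ℝ] E)) (pointwiseApply (superpose B.f₁ _) X₂) u)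
    + stateRate₂ hab A B _ u X₁ v
  rw [stateRate₂]
  abel

/-- The integral over `[a, b]` as a bounded linear functional on `L¹`. -/
def integralL1 : Lp ℝ 1 ((volume : Measure ℝ).restrict (Ioc a b)) →L[ℝ] ℝ :=
  (ContinuousMap.evalCLM ℝ (⟨b, right_mem_Icc.2 hab⟩ : Icc a b)).comp (primitive hab)

theorem integralL1_apply (f : Lp ℝ 1 ((volume : Measure ℝ).restrict (Ioc a b))) :
    integralL1 hab f = ∫ r in a..b, f r := rfl

variable (Q : C2Coeff (Icc a b) E ℝ) (S : C2Coeff (Icc a b) E V)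
  (R : C2Coeff (Icc a b) E (V →L[ℝ] V)) (G : E → ℝ)

/-- The pointwise inner product `L² × L² → L¹`. -/
def innerL1 : Lp V 2 ((volume : Measure ℝ).restrict (Ioc a b)) →L[ℝ]
    Lp V 2 ((volume : Measure ℝ).restrict (Ioc a b)) →L[ℝ]
      Lp ℝ 1 ((volume : Measure ℝ).restrict (Ioc a b)) :=
  (innerSL ℝ).holderL _ 2 2 1

theorem coeFn_innerL1 {u v : Lp V 2 ((volume : Measure ℝ).restrict (Ioc a b))} {φ γ : ℝ → V}
    (hu : u =ᵐ[(volume : Measure ℝ).restrict (Ioc a b)] φ)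
    (hv : v =ᵐ[(volume : Measure ℝ).restrict (Ioc a b)] γ) :
    innerL1 u v =ᵐ[(volume : Measure ℝ).restrict (Ioc a b)] fun r => ⟪φ r, γ r⟫_ℝ := by
  filter_upwards [(innerSL ℝ).coeFn_holder (r := 1) u v, hu, hv] with r h1 h2 h3
  rw [← h2, ← h3]
  exact h1

/-- The running cost, as an integrable function. -/
def costDensity (X : C(Icc a b, E)) (u : Lp V 2 ((volume : Measure ℝ).restrict (Ioc a b))) :
    Lp ℝ 1 ((volume : Measure ℝ).restrict (Ioc a b)) :=
  continuousToLp hab 1 (superpose Q.f₀ X)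
    + (mulL1 hab (innerSL ℝ) (superpose S.f₀ X) u
      + (1 / 2 : ℝ) • innerL1 (mulL2 hab (ContinuousLinearMap.id ℝ (V →L[ℝ] V))
          (superpose R.f₀ X) u) u)

theorem coeFn_costDensity (X : C(Icc a b, E))
    (u : Lp V 2 ((volume : Measure ℝ).restrict (Ioc a b))) :
    costDensity hab Q S R X u =ᵐ[(volume : Measure ℝ).restrict (Ioc a b)] fun r =>
      Q.f₀ (projIcc a b hab r, X (projIcc a b hab r))
        + (⟪S.f₀ (projIcc a b hab r, X (projIcc a b hab r)), u r⟫_ℝ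
          + (1 / 2 : ℝ) • ⟪R.f₀ (projIcc a b hab r, X (projIcc a b hab r)) (u r), u r⟫_ℝ) :=
  Lp_coeFn_add_ae_eq (coeFn_continuousToLp hab 1 _) (Lp_coeFn_add_ae_eq
    (coeFn_mulL1 hab (innerSL ℝ) _ u) (Lp_coeFn_smul_ae_eq (1 / 2)
      (coeFn_innerL1 (coeFn_mulL2 hab _ _ u) Filter.EventuallyEq.rfl)))

/-- The cost functional, as a function of the control. -/
def costMap (hL : LipschitzCoeffs A B) (x : E)
    (u : Lp V 2 ((volume : Measure ℝ).restrict (Ioc a b))) : ℝ :=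
  integralL1 hab (costDensity hab Q S R (stateMap hab hL x u) u)
    + G (stateMap hab hL x u ⟨b, right_mem_Icc.2 hab⟩)

theorem contDiff_costMap [CompleteSpace V] (hL : LipschitzCoeffs A B) (x : E)
    (hG : ContDiff ℝ 2 G) : ContDiff ℝ 2 (costMap hab Q S R G hL x) := by
  have hs := contDiff_stateMap hab hL x
  have hQ : ContDiff ℝ 2 fun u => superpose Q.f₀ (stateMap hab hL x u) := Q.contDiff.comp hs
  have hS : ContDiff ℝ 2 fun u => superpose S.f₀ (stateMap hab hL x u) := S.contDiff.comp hs
  have hR : ContDiff ℝ 2 fun u => superpose R.f₀ (stateMap hab hL x u) := R.contDiff.comp hs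
  have h1 := (continuousToLp (E := ℝ) hab 1).contDiff.comp hQ
  have h2 := ((mulL1 hab (innerSL (E := V) ℝ)).contDiff.comp hS).clm_apply contDiff_id
  have h3 := ((mulL2 hab (ContinuousLinearMap.id ℝ (V →L[ℝ] V))).contDiff.comp hR).clm_apply
    contDiff_id
  have h4 := ((innerL1 (V := V) (a := a) (b := b)).contDiff.comp h3).clm_apply contDiff_id
  have h5 := (integralL1 hab).contDiff.comp (h1.add (h2.add (h4.const_smul (1 / 2 : ℝ))))
  have h6 := hG.comp ((ContinuousMap.evalCLM ℝ
    (⟨b, right_mem_Icc.2 hab⟩ : Icc a b) : C(Icc a b, E) →L[ℝ] E).contDiff.comp hs)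
  exact h5.add h6

/-- The pointwise second variation of the running cost. -/
def costRate₂ (X : C(Icc a b, E)) (u : Lp V 2 ((volume : Measure ℝ).restrict (Ioc a b)))
    (X₁ X₂ : C(Icc a b, E)) (v : Lp V 2 ((volume : Measure ℝ).restrict (Ioc a b))) (r : ℝ) : ℝ :=
  let k := projIcc a b hab r
  (Q.f₂ (k, X k) (X₁ k) (X₁ k) + Q.f₁ (k, X k) (X₂ k))
    + ((⟪S.f₂ (k, X k) (X₁ k) (X₁ k) + S.f₁ (k, X k) (X₂ k), u r⟫_ℝ
        + (2 : ℝ) • ⟪S.f₁ (k, X k) (X₁ k), v r⟫_ℝ)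
      + (1 / 2 : ℝ) • (⟪(R.f₂ (k, X k) (X₁ k) (X₁ k) + R.f₁ (k, X k) (X₂ k)) (u r)
            + (2 : ℝ) • R.f₁ (k, X k) (X₁ k) (v r), u r⟫_ℝ
          + (2 : ℝ) • ⟪R.f₁ (k, X k) (X₁ k) (u r) + R.f₀ (k, X k) (v r), v r⟫_ℝ))

/-- The jet of the cost along the line is computed twice, from the smoothness of `costMap` and by
the rules for sums and bilinear maps. Integrability comes for free because `costRate₂` represents an
element of `L¹`. -/
theorem costMap_second_derivative [CompleteSpace V] (hL : LipschitzCoeffs A B) (x : E)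
    (hG : ContDiff ℝ 2 G) (u v : Lp V 2 ((volume : Measure ℝ).restrict (Ioc a b)))
    {X₁ X₂ : C(Icc a b, E)}
    (hX : HasJet2 (fun ε : ℝ => stateMap hab hL x (u + ε • v)) X₁ X₂) :
    IntervalIntegrable (costRate₂ hab Q S R (stateMap hab hL x u) u X₁ X₂ v) volume a b ∧
    fderiv ℝ (fderiv ℝ (costMap hab Q S R G hL x)) u v v =
      (∫ r in a..b, costRate₂ hab Q S R (stateMap hab hL x u) u X₁ X₂ v r)
      + (fderiv ℝ (fderiv ℝ G) (stateMap hab hL x u ⟨b, right_mem_Icc.2 hab⟩)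
          (X₁ ⟨b, right_mem_Icc.2 hab⟩) (X₁ ⟨b, right_mem_Icc.2 hab⟩)
        + fderiv ℝ G (stateMap hab hL x u ⟨b, right_mem_Icc.2 hab⟩)
          (X₂ ⟨b, right_mem_Icc.2 hab⟩)) := by
  have h0 : u + (0 : ℝ) • v = u := by simp
  have hJ := (HasJet2.line u v).comp_contDiff (contDiff_costMap hab Q S R G hL x hG)
  have hQ := (hX.superposition Q).clm (continuousToLp hab 1)
  have hS := HasJet2.bilin (mulL1 hab (innerSL ℝ)) (hX.superposition S) (HasJet2.line u v)
  have hR := HasJet2.bilin (mulL2 hab (ContinuousLinearMap.id ℝ (V →L[ℝ] V)))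
    (hX.superposition R) (HasJet2.line u v)
  have hR2 := HasJet2.bilin innerL1 hR (HasJet2.line u v)
  have hR3 := hR2.clm ((1 / 2 : ℝ) • ContinuousLinearMap.id ℝ _)
  have hD := (hQ.add (hS.add hR3)).clm (integralL1 hab)
  have hGj := HasJet2.comp_contDiff hG (hX.clm (ContinuousMap.evalCLM ℝ
    (⟨b, right_mem_Icc.2 hab⟩ : Icc a b) : C(Icc a b, E) →L[ℝ] E))
  have key := (hJ.unique (hD.add hGj)).2
  simp only [h0, map_zero, add_zero] at key
  rw [key, integralL1_apply]
  -- The element of `L¹` produced by the jet calculus is replaced, summand by summand, by its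
  -- pointwise representative.
  have hae : ((continuousToLp hab 1 _ + (_ + _) : Lp ℝ 1 _)) =ᵐ[volume.restrict (Ioc a b)]
      costRate₂ hab Q S R (stateMap hab hL x u) u X₁ X₂ v :=
    Lp_coeFn_add_ae_eq (coeFn_continuousToLp hab 1
      (pointwiseApply (pointwiseApply (superpose Q.f₂ (stateMap hab hL x u)) X₁) X₁
        + pointwiseApply (superpose Q.f₁ (stateMap hab hL x u)) X₂))
    (Lp_coeFn_add_ae_eq (Lp_coeFn_add_ae_eq (coeFn_mulL1 hab (innerSL ℝ) 
      (pointwiseApply (pointwiseApply (superpose S.f₂ (stateMap hab hL x u)) X₁) X₁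
        + pointwiseApply (superpose S.f₁ (stateMap hab hL x u)) X₂) u)
      (Lp_coeFn_smul_ae_eq 2 (coeFn_mulL1 hab (innerSL ℝ) 
        (pointwiseApply (superpose S.f₁ (stateMap hab hL x u)) X₁) v)))
      (Lp_coeFn_smul_ae_eq (1 / 2) (Lp_coeFn_add_ae_eq
        (coeFn_innerL1 (Lp_coeFn_add_ae_eq (coeFn_mulL2 hab
            (ContinuousLinearMap.id ℝ (V →L[ℝ] V))
            (pointwiseApply (pointwiseApply (superpose R.f₂ (stateMap hab hL x u)) X₁) X₁
              + pointwiseApply (superpose R.f₁ (stateMap hab hL x u)) X₂) u)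
          (Lp_coeFn_smul_ae_eq 2 (coeFn_mulL2 hab (ContinuousLinearMap.id ℝ (V →L[ℝ] V))
            (pointwiseApply (superpose R.f₁ (stateMap hab hL x u)) X₁) v)))
          (Filter.EventuallyEq.refl _ u))
        (Lp_coeFn_smul_ae_eq 2 (coeFn_innerL1 (Lp_coeFn_add_ae_eq
          (coeFn_mulL2 hab (ContinuousLinearMap.id ℝ (V →L[ℝ] V))
            (pointwiseApply (superpose R.f₁ (stateMap hab hL x u)) X₁) u)
          (coeFn_mulL2 hab (ContinuousLinearMap.id ℝ (V →L[ℝ] V))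
            (superpose R.f₀ (stateMap hab hL x u)) v))
          (Filter.EventuallyEq.refl _ v))))))
  refine ⟨?_, congrArg₂ (· + ·)
    (intervalIntegral_congr_ae_restrict hae (right_mem_Icc.2 hab)) rfl⟩
  rw [intervalIntegrable_iff_integrableOn_Ioc_of_le hab]
  exact (L1.integrable_coeFn _).congr hae

end SecondVariation

/-! ### Gradients, Hessians and adjoints through the Riesz isomorphism. -/

section Riesz

variable {E F V : Type*} [NormedAddCommGroup E] [InnerProductSpace ℝ E] [CompleteSpace E]
  [NormedAddCommGroup F] [InnerProductSpace ℝ F] [CompleteSpace F]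
  [NormedAddCommGroup V] [NormedSpace ℝ V]

variable (E) in
/-- The Riesz isomorphism from the dual of a real Hilbert space, as a bounded linear map. -/
def rieszCLM : (E →L[ℝ] ℝ) →L[ℝ] E :=
  LinearMap.mkContinuous
    { toFun := fun φ => (InnerProductSpace.toDual ℝ E).symm φ
      map_add' := fun φ ψ => map_add _ φ ψ
      map_smul' := fun c φ => by simp } 1
    (fun φ => by simp)

theorem gradient_eq_rieszCLM (f : E → ℝ) (x : E) : gradient f x = rieszCLM E (fderiv ℝ f x) := rfl

theorem inner_rieszCLM (φ : E →L[ℝ] ℝ) (y : E) : ⟪rieszCLM E φ, y⟫_ℝ = φ y :=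
  InnerProductSpace.toDual_symm_apply

theorem adjoint_apply_eq_rieszCLM (M : E →L[ℝ] F) (y : F) :
    M.adjoint y = rieszCLM E ((innerSL ℝ y).comp M) := by
  refine ext_inner_right ℝ fun z => ?_
  rw [inner_rieszCLM, ContinuousLinearMap.adjoint_inner_left]
  rfl

theorem hasFDerivAt_gradient_clm_comp {f : E → V} {f₁ : E → E →L[ℝ] V} {f₂ : E →L[ℝ] E →L[ℝ] V}
    {x : E} (h1 : ∀ z, HasFDerivAt f (f₁ z) z) (h2 : HasFDerivAt f₁ f₂ x) (L : V →L[ℝ] ℝ) :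
    HasFDerivAt (gradient fun z => L (f z))
      ((rieszCLM E).comp ((ContinuousLinearMap.compL ℝ E V ℝ L).comp f₂)) x := by
  have h3 : (gradient fun z => L (f z)) =
      fun z => rieszCLM E (ContinuousLinearMap.compL ℝ E V ℝ L (f₁ z)) := by
    ext1 z
    rw [gradient_eq_rieszCLM]
    exact congrArg _ (L.hasFDerivAt.comp z (h1 z)).fderiv
  rw [h3]
  exact (rieszCLM E).hasFDerivAt.comp x
    ((ContinuousLinearMap.compL ℝ E V ℝ L).hasFDerivAt.comp x h2)

/-- Each Hessian in `bA₁` is that of a linear functional `L` of a coefficient, with `y` and `u`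
frozen in `L`. The gradient is a bounded linear image of `f₁`, so its derivative is the same image
of `f₂`. -/
theorem inner_fderiv_gradient_clm_comp {f : E → V} {f₁ : E → E →L[ℝ] V}
    {f₂ : E →L[ℝ] E →L[ℝ] V} {x : E} (h1 : ∀ z, HasFDerivAt f (f₁ z) z)
    (h2 : HasFDerivAt f₁ f₂ x) (L : V →L[ℝ] ℝ) (h k : E) :
    ⟪fderiv ℝ (gradient fun z => L (f z)) x h, k⟫_ℝ = L (f₂ h k) := by
  rw [(hasFDerivAt_gradient_clm_comp h1 h2 L).fderiv]
  exact inner_rieszCLM _ _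

theorem inner_gradient_clm_comp {f : E → V} {f₁ : E →L[ℝ] V} {x : E} (h1 : HasFDerivAt f f₁ x)
    (L : V →L[ℝ] ℝ) (h : E) : ⟪gradient (fun z => L (f z)) x, h⟫_ℝ = L (f₁ h) := by
  rw [gradient_eq_rieszCLM, inner_rieszCLM]
  exact congrArg (fun M : E →L[ℝ] ℝ => M h) (L.hasFDerivAt.comp x h1).fderiv

theorem differentiable_gradient {f : E → ℝ} (hf : ContDiff ℝ 2 f) :
    Differentiable ℝ (gradient f) := fun x =>
  (rieszCLM E).differentiableAt.comp x
    ((hf.fderiv_right (m := 1) (by norm_num)).differentiable (by norm_num) x)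

theorem inner_fderiv_gradient {f : E → ℝ} (hf : ContDiff ℝ 2 f) (x h k : E) :
    ⟪fderiv ℝ (gradient f) x h, k⟫_ℝ = fderiv ℝ (fderiv ℝ f) x h k :=
  inner_fderiv_gradient_clm_comp (f := f) (f₁ := fderiv ℝ f)
    (fun z => (hf.differentiable (by norm_num) z).hasFDerivAt)
    ((hf.fderiv_right (m := 1) (by norm_num)).differentiable (by norm_num) x).hasFDerivAt
    (ContinuousLinearMap.id ℝ ℝ) h k

/-- This is Schwarz's theorem; it supplies the symmetry contained in the operator order. -/
theorem isSymmetric_fderiv_gradient {f : E → ℝ} (hf : ContDiff ℝ 2 f) (x h k : E) :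
    ⟪fderiv ℝ (gradient f) x h, k⟫_ℝ = ⟪h, fderiv ℝ (gradient f) x k⟫_ℝ := by
  rw [real_inner_comm _ h, inner_fderiv_gradient hf, inner_fderiv_gradient hf]
  exact second_derivative_symmetric
    (fun z => (hf.differentiable (by norm_num) z).hasFDerivAt)
    ((hf.fderiv_right (m := 1) (by norm_num)).differentiable (by norm_num) x).hasFDerivAt h k

end Riesz

/-! ### Space derivatives of coefficients that are smooth on the closed strip. -/

section PartialDerivatives

variable {E V : Type*} [NormedAddCommGroup E] [NormedSpace ℝ E] [NormedAddCommGroup V]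
  [NormedSpace ℝ V] {T : ℝ}

theorem uniqueDiffOn_Icc_prod_univ (hT : 0 < T) :
    UniqueDiffOn ℝ (Icc 0 T ×ˢ (univ : Set E)) :=
  (uniqueDiffOn_Icc hT).prod uniqueDiffOn_univ

/-- Each slice `{s} × E` lies wholly in the strip, so a derivative within the strip gives a genuine
space derivative even at the end times. -/
theorem hasFDerivAt_partial {f : ℝ → E → V}
    (hf : DifferentiableOn ℝ (fun p : ℝ × E => f p.1 p.2) (Icc 0 T ×ˢ univ)) {s : ℝ}
    (hs : s ∈ Icc 0 T) (x : E) :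
    HasFDerivAt (f s) ((fderivWithin ℝ (fun p : ℝ × E => f p.1 p.2) (Icc 0 T ×ˢ univ) (s, x)).comp
      (ContinuousLinearMap.inr ℝ ℝ E)) x := by
  rw [← hasFDerivWithinAt_univ]
  exact (hf (s, x) ⟨hs, mem_univ x⟩).hasFDerivWithinAt.comp x
    (hasFDerivAt_prodMk_right s x).hasFDerivWithinAt fun z _ => ⟨hs, mem_univ z⟩

/-- The space derivative is the derivative within the strip restricted to the second factor.
Smoothness of the latter needs unique differentiability of the strip, hence `0 < T`. -/
theorem contDiffOn_partial (hT : 0 < T) {f : ℝ → E → V} {k : ℕ}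
    (hf : ContDiffOn ℝ (k + 1) (fun p : ℝ × E => f p.1 p.2) (Icc 0 T ×ˢ univ)) :
    ContDiffOn ℝ k (fun p : ℝ × E => fderiv ℝ (f p.1) p.2) (Icc 0 T ×ˢ univ) := by
  have h1 := hf.fderivWithin (m := k) (uniqueDiffOn_Icc_prod_univ hT) le_rfl
  have h2 : ContDiffOn ℝ k (fun p : ℝ × E =>
      (fderivWithin ℝ (fun p : ℝ × E => f p.1 p.2) (Icc 0 T ×ˢ univ) p).comp
      (ContinuousLinearMap.inr ℝ ℝ E)) (Icc 0 T ×ˢ univ) := h1.clm_comp contDiffOn_const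
  refine h2.congr fun p hp => ?_
  exact (hasFDerivAt_partial (hf.differentiableOn (by simp)) hp.1 p.2).fderiv

theorem continuous_restrict_prod {W : Type*} [TopologicalSpace W] {f : ℝ × E → W}
    (hf : ContinuousOn f (Icc 0 T ×ˢ univ)) {t : ℝ} (ht : 0 ≤ t) :
    Continuous fun p : Icc t T × E => f (p.1, p.2) := by
  refine hf.comp_continuous (by fun_prop) fun p => ⟨⟨ht.trans p.1.2.1, p.1.2.2⟩, mem_univ _⟩

/-- The coefficient on `[t, T]` given by a twice continuously differentiable function on
`[0, T] × E`. -/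
def C2Coeff.ofContDiffOn (hT : 0 < T) {f : ℝ → E → V}
    (hf : ContDiffOn ℝ 2 (fun p : ℝ × E => f p.1 p.2) (Icc 0 T ×ˢ univ)) {t : ℝ} (ht : 0 ≤ t) :
    C2Coeff (Icc t T) E V :=
  have h1 : ContDiffOn ℝ (1 : ℕ) (fun p : ℝ × E => fderiv ℝ (f p.1) p.2) (Icc 0 T ×ˢ univ) :=
    contDiffOn_partial hT (by simpa [one_add_one_eq_two] using hf)
  have h2 : ContDiffOn ℝ (0 : ℕ) (fun p : ℝ × E => fderiv ℝ (fderiv ℝ (f p.1)) p.2)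
      (Icc 0 T ×ˢ univ) := contDiffOn_partial (k := 0) (f := fun s x => fderiv ℝ (f s) x) hT (by simpa using h1)
  { f₀ := ⟨fun p => f p.1 p.2, continuous_restrict_prod hf.continuousOn ht⟩
    f₁ := ⟨fun p => fderiv ℝ (f p.1) p.2, continuous_restrict_prod h1.continuousOn ht⟩
    f₂ := ⟨fun p => fderiv ℝ (fderiv ℝ (f p.1)) p.2, continuous_restrict_prod h2.continuousOn ht⟩
    hasFDerivAt₀ := fun s x => (hasFDerivAt_partial (hf.differentiableOn (by norm_num))
      ⟨ht.trans s.2.1, s.2.2⟩ x).differentiableAt.hasFDerivAt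
    hasFDerivAt₁ := fun s x => (hasFDerivAt_partial (f := fun s x => fderiv ℝ (f s) x)
      (h1.differentiableOn (by simp))
      ⟨ht.trans s.2.1, s.2.2⟩ x).differentiableAt.hasFDerivAt }

end PartialDerivatives

/-! ### Duality of the linearized and the adjoint equation. -/

section Duality

variable {E V : Type*} [NormedAddCommGroup E] [InnerProductSpace ℝ E] [CompleteSpace E]
  [NormedAddCommGroup V] [InnerProductSpace ℝ V] {a b : ℝ} (hab : a ≤ b)
  (A : C2Coeff (Icc a b) E E) (B : C2Coeff (Icc a b) E (V →L[ℝ] E))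

/-- Duality between the linearized state equation and the adjoint equation. -/
theorem inner_adjoint_terminal {X X₂ : C(Icc a b, E)}
    {u : Lp V 2 ((volume : Measure ℝ).restrict (Ioc a b))}
    {f : Lp E 1 ((volume : Measure ℝ).restrict (Ioc a b))}
    (hX₂ : X₂ = primitive hab (linearRate hab A B X u X₂ + f)) {Y η : ℝ → E} {p : E} {q : ℝ → ℝ}
    (hη : IntervalIntegrable η volume a b)
    (hY : ∀ s ∈ Icc a b, Y s = p + ∫ r in s..b, η r)
    (hq : ∀ᵐ r ∂(volume : Measure ℝ).restrict (Ioc a b),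
      ⟪η r, X₂ (projIcc a b hab r)⟫_ℝ =
        ⟪Y r, A.f₁ (projIcc a b hab r, X (projIcc a b hab r)) (X₂ (projIcc a b hab r))
          + B.f₁ (projIcc a b hab r, X (projIcc a b hab r)) (X₂ (projIcc a b hab r)) (u r)⟫_ℝ
        + q r) :
    ⟪p, X₂ ⟨b, right_mem_Icc.2 hab⟩⟫_ℝ = ∫ r in a..b, (⟪Y r, f r⟫_ℝ - q r) := by
  set ξ := linearRate hab A B X u X₂ + f with hξ
  have hx : ∀ s ∈ Icc a b, IccExtend hab X₂ s = IccExtend hab X₂ a + ∫ r in a..s, ξ r := by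
    intro s hs
    rw [IccExtend_of_mem hab _ hs, IccExtend_of_mem hab _ (left_mem_Icc.2 hab), hX₂,
      primitive_apply, primitive_apply]
    simp
  have hxa : IccExtend hab X₂ a = 0 := by
    rw [IccExtend_of_mem hab _ (left_mem_Icc.2 hab), hX₂, primitive_apply]
    simp
  -- The backward equation is rewritten as a forward one so that the product rule applies.
  have hy : ∀ s ∈ Icc a b, Y s = Y a + ∫ r in a..s, -η r := by
    intro s hs
    have h1 := intervalIntegrable_coeFn_sub hab hη hs
    have h2 : IntervalIntegrable η volume s b := hη.mono_set (by
      rw [uIcc_of_le hs.2, uIcc_of_le hab]; exact Icc_subset_Icc_left hs.1)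
    rw [hY s hs, hY a (left_mem_Icc.2 hab), intervalIntegral.integral_neg,
      ← intervalIntegral.integral_add_adjacent_intervals h1 h2]
    abel
  -- The product rule for `⟨Y, X₂⟩`: as `X₂` vanishes at `a`, only the terminal pairing survives,
  -- and by `hq` the linear rate cancels and leaves `⟨Y, f⟩ - q`.
  have key := bilin_eq_add_integral (innerSL ℝ (E := E)) hab hη.neg
    (intervalIntegrable_coeFn hab ξ) hy hx
  have hyb : Y b = p := by simpa using hY b (right_mem_Icc.2 hab)
  rw [hxa, hyb, IccExtend_of_mem hab _ (right_mem_Icc.2 hab), map_zero, zero_add] at key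
  refine key.trans (intervalIntegral_congr_ae_restrict ?_ (right_mem_Icc.2 hab))
  have h3 := Lp_coeFn_add_ae_eq (coeFn_linearRate hab A B X u X₂) (Filter.EventuallyEq.refl _ f)
  filter_upwards [hq, h3] with r h1 h2
  change ⟪-η r, X₂ (projIcc a b hab r)⟫_ℝ + ⟪Y r, ξ r⟫_ℝ = _
  rw [hξ, h2, inner_neg_left, h1]
  simp only [inner_add_right]
  change -(_ + _ + q r) + (⟪Y r, A.f₁ (projIcc a b hab r, X (projIcc a b hab r))
    (X₂ (projIcc a b hab r))⟫_ℝ + ⟪Y r, B.f₁ (projIcc a b hab r, X (projIcc a b hab r))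
      (X₂ (projIcc a b hab r)) (u r)⟫_ℝ + _) = _
  ring

end Duality

/-! ### Fundamental matrices and variation of constants. -/

section FundamentalMatrix

variable {E : Type*} [NormedAddCommGroup E] [NormedSpace ℝ E] [FiniteDimensional ℝ E] {a b : ℝ}

theorem intervalIntegrable_mono_Icc {F : Type*} [NormedAddCommGroup F] {f : ℝ → F}
    (hf : IntervalIntegrable f volume a b) {s t : ℝ} (hs : a ≤ s) (hst : s ≤ t) (ht : t ≤ b) :
    IntervalIntegrable f volume s t :=
  hf.mono_set (by
    rw [uIcc_of_le hst, uIcc_of_le (hs.trans (hst.trans ht))]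
    exact Icc_subset_Icc hs ht)

/-- The inverse fundamental matrix: a solution of `Z' = -Z M`, `Z(a) = 1`. -/
theorem exists_inverse_fundamental (hab : a ≤ b) {M : ℝ → E →L[ℝ] E}
    (hM : IntervalIntegrable M volume a b)
    (hM2 : IntervalIntegrable (fun r => ‖M r‖ ^ 2) volume a b) :
    ∃ Z : ℝ → E →L[ℝ] E, Continuous Z ∧
      ∀ s ∈ Icc a b, Z s = 1 + ∫ r in a..s, -(Z r ∘L M r) := by
  have : CompleteSpace E := FiniteDimensional.complete ℝ E
  have hint : ∀ Z : C(Icc a b, E →L[ℝ] E), Integrable (fun r => -(IccExtend hab Z r ∘L M r))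
      ((volume : Measure ℝ).restrict (Ioc a b)) := by
    intro Z
    have h := intervalIntegrable_bilin_left (ContinuousLinearMap.compL ℝ E E E).flip hab hM
      (continuous_iccExtend hab Z).continuousOn
    rw [intervalIntegrable_iff_integrableOn_Ioc_of_le hab] at h
    exact h.neg
  obtain ⟨Z, hZ, -⟩ := existsUnique_volterra hab (fun Z => (hint Z).toL1 _) hM2 (fun Z W => by
    filter_upwards [(hint Z).coeFn_toL1, (hint W).coeFn_toL1] with r h1 h2
    rw [h1, h2, neg_sub_neg, ← ContinuousLinearMap.sub_comp, norm_sub_rev]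
    refine (ContinuousLinearMap.opNorm_comp_le _ _).trans (le_of_eq ?_)
    rw [mul_comm, norm_sub_rev]) (ContinuousMap.const _ 1)
  refine ⟨IccExtend hab Z, continuous_iccExtend hab Z, fun s hs => ?_⟩
  have h1 := congrArg (fun X : C(Icc a b, E →L[ℝ] E) => X ⟨s, hs⟩) hZ
  rw [IccExtend_of_mem hab _ hs]
  refine h1.trans ?_
  rw [ContinuousMap.add_apply, primitive_apply]
  exact congrArg₂ (· + ·) rfl (intervalIntegral_congr_ae_restrict (hint Z).coeFn_toL1 hs)

/-- A fundamental matrix factors as `Φ(s, τ) = Ψ(s) Z(τ)` with continuous factors, and provides the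
solutions of the inhomogeneous equation (variation of constants). -/
theorem exists_factor_fundamental (hab : a ≤ b) {M : ℝ → E →L[ℝ] E}
    (hM : IntervalIntegrable M volume a b)
    (hM2 : IntervalIntegrable (fun r => ‖M r‖ ^ 2) volume a b) {Φ : ℝ → ℝ → E →L[ℝ] E}
    (hΦ : ∀ τ ∈ Icc a b, ContinuousOn (fun s => Φ s τ) (Icc τ b) ∧
      ∀ s ∈ Icc τ b, Φ s τ = 1 + ∫ r in τ..s, M r ∘L Φ r τ) :
    ∃ Ψ Z : ℝ → E →L[ℝ] E, ContinuousOn Ψ (Icc a b) ∧ Continuous Z ∧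
      (∀ τ ∈ Icc a b, ∀ s ∈ Icc τ b, Φ s τ = Ψ s ∘L Z τ) ∧
      ∀ X g : ℝ → E, ContinuousOn X (Icc a b) → IntervalIntegrable g volume a b →
        (∀ s ∈ Icc a b, X s = ∫ r in a..s, (M r (X r) + g r)) →
        ∀ s ∈ Icc a b, X s = ∫ r in a..s, Φ s r (g r) := by
  have : CompleteSpace E := FiniteDimensional.complete ℝ E
  obtain ⟨Z, hZc, hZ⟩ := exists_inverse_fundamental hab hM hM2
  have hZM : IntervalIntegrable (fun r => -(Z r ∘L M r)) volume a b :=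
    (intervalIntegrable_bilin_left (ContinuousLinearMap.compL ℝ E E E).flip hab hM
      hZc.continuousOn).neg
  have hZa : Z a = 1 := by simpa using hZ a (left_mem_Icc.2 hab)
  have hZτ : ∀ τ ∈ Icc a b, ∀ s ∈ Icc τ b, Z s = Z τ + ∫ r in τ..s, -(Z r ∘L M r) := by
    intro τ hτ s hs
    rw [hZ τ hτ, hZ s ⟨hτ.1.trans hs.1, hs.2⟩, add_assoc,
      intervalIntegral.integral_add_adjacent_intervals
        (intervalIntegrable_mono_Icc hZM le_rfl hτ.1 hτ.2)
        (intervalIntegrable_mono_Icc hZM hτ.1 hs.1 hs.2)]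
  -- The derivative of `Z Φ(·, τ)` is `-ZMΦ + ZMΦ = 0`.
  have key : ∀ τ ∈ Icc a b, ∀ s ∈ Icc τ b, Z s ∘L Φ s τ = Z τ := by
    intro τ hτ s hs
    have hc := (hΦ τ hτ).1
    have hΦτ : Φ τ τ = 1 := by simpa using (hΦ τ hτ).2 τ (left_mem_Icc.2 hτ.2)
    have hi : IntervalIntegrable (fun r => M r ∘L Φ r τ) volume τ s :=
      intervalIntegrable_bilin_left (ContinuousLinearMap.compL ℝ E E E) hs.1
        (intervalIntegrable_mono_Icc hM hτ.1 hs.1 hs.2) (hc.mono (Icc_subset_Icc_right hs.2))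
    have h := bilin_eq_add_integral (f := Z) (g := fun r => Φ r τ)
      (ContinuousLinearMap.compL ℝ E E E) hs.1
      (intervalIntegrable_mono_Icc hZM hτ.1 hs.1 hs.2) hi
      (fun r hr => hZτ τ hτ r ⟨hr.1, hr.2.trans hs.2⟩)
      (fun r hr => by rw [hΦτ]; exact (hΦ τ hτ).2 r ⟨hr.1, hr.2.trans hs.2⟩)
    have h0 : ∀ r, ContinuousLinearMap.compL ℝ E E E (-(Z r ∘L M r)) (Φ r τ)
        + ContinuousLinearMap.compL ℝ E E E (Z r) (M r ∘L Φ r τ) = 0 := by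
      intro r
      ext x
      simp
    simp only [h0, intervalIntegral.integral_zero, add_zero, hΦτ] at h
    exact h
  -- In finite dimension the left inverse from `key` is also a right inverse.
  have hinv : ∀ s ∈ Icc a b, Φ s a ∘L Z s = 1 := by
    intro s hs
    have h1 : Z s * Φ s a = 1 := by rw [← hZa]; exact key a (left_mem_Icc.2 hab) s hs
    have h2 : (Z s : E →ₗ[ℝ] E) * (Φ s a : E →ₗ[ℝ] E) = 1 := by
      ext x
      exact congrArg (fun L : E →L[ℝ] E => L x) h1
    rw [mul_eq_one_comm] at h2
    ext x
    exact congrArg (fun L : E →ₗ[ℝ] E => L x) h2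
  have hfac : ∀ τ ∈ Icc a b, ∀ s ∈ Icc τ b, Φ s τ = Φ s a ∘L Z τ := by
    intro τ hτ s hs
    rw [← key τ hτ s hs, ← ContinuousLinearMap.comp_assoc, hinv s ⟨hτ.1.trans hs.1, hs.2⟩]
    rfl
  refine ⟨fun s => Φ s a, Z, (hΦ a (left_mem_Icc.2 hab)).1, hZc, hfac,
    fun X g hX hg hXeq s hs => ?_⟩
  have hMX : IntervalIntegrable (fun r => M r (X r)) volume a b :=
    intervalIntegrable_bilin_left (ContinuousLinearMap.id ℝ (E →L[ℝ] E)) hab hM hX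
  have hXa : X a = 0 := by simpa using hXeq a (left_mem_Icc.2 hab)
  -- The derivative of `Z X` is `Z g`, so `X` is recovered by applying `Φ s a` to the integral of `Z
  -- g`.
  have h := bilin_eq_add_integral (f := Z) (g := X) (ContinuousLinearMap.id ℝ (E →L[ℝ] E)) hs.1
    (intervalIntegrable_mono_Icc hZM le_rfl hs.1 hs.2)
    (intervalIntegrable_mono_Icc (hMX.add hg) le_rfl hs.1 hs.2)
    (fun r hr => by rw [hZa]; exact hZ r ⟨hr.1, hr.2.trans hs.2⟩)
    (fun r hr => by rw [hXa, zero_add]; exact hXeq r ⟨hr.1, hr.2.trans hs.2⟩)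
  have h0 : ∀ r, ContinuousLinearMap.id ℝ (E →L[ℝ] E) (-(Z r ∘L M r)) (X r)
      + ContinuousLinearMap.id ℝ (E →L[ℝ] E) (Z r) (M r (X r) + g r) = Z r (g r) := by
    intro r
    simp
  simp only [h0, hXa, map_zero, zero_add] at h
  have hZg : IntervalIntegrable (fun r => Z r (g r)) volume a s :=
    intervalIntegrable_bilin_left (ContinuousLinearMap.id ℝ (E →L[ℝ] E)).flip hs.1
      (intervalIntegrable_mono_Icc hg le_rfl hs.1 hs.2) hZc.continuousOn
  calc X s = (Φ s a ∘L Z s) (X s) := by rw [hinv s hs]; rfl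
    _ = Φ s a (∫ r in a..s, Z r (g r)) := by rw [← h]; rfl
    _ = ∫ r in a..s, Φ s a (Z r (g r)) :=
        ((Φ s a).intervalIntegral_comp_comm hZg).symm
    _ = _ := by
      refine intervalIntegral.integral_congr fun r hr => ?_
      rw [uIcc_of_le hs.1] at hr
      rw [hfac r ⟨hr.1, hr.2.trans hs.2⟩ s ⟨hr.2, hs.2⟩]
      rfl

end FundamentalMatrix

/-! ### The control problem in terms of the abstract state and cost maps. -/

namespace AQProblem

section StateAndCost

variable {n m : ℕ} {P : AQProblem n m} (hT : 0 < P.T) (h1 : P.H1) (h3 : P.H3) {t : ℝ}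
  (ht : t ∈ Icc 0 P.T)

/-- The coefficient `A` on `[t, T]`. -/
abbrev coeffA : C2Coeff (Icc t P.T) (RVec n) (RVec n) :=
  C2Coeff.ofContDiffOn hT h3.smooth_A ht.1

/-- The coefficient `B` on `[t, T]`. -/
abbrev coeffB : C2Coeff (Icc t P.T) (RVec n) (RMat n m) :=
  C2Coeff.ofContDiffOn hT h3.smooth_B ht.1

/-- The coefficient `Q` on `[t, T]`. -/
abbrev coeffQ : C2Coeff (Icc t P.T) (RVec n) ℝ :=
  C2Coeff.ofContDiffOn hT h3.smooth_Q ht.1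

/-- The coefficient `S` on `[t, T]`. -/
abbrev coeffS : C2Coeff (Icc t P.T) (RVec n) (RVec m) :=
  C2Coeff.ofContDiffOn hT h3.smooth_S ht.1

/-- The coefficient `R` on `[t, T]`. -/
abbrev coeffR : C2Coeff (Icc t P.T) (RVec n) (RMat m m) :=
  C2Coeff.ofContDiffOn hT h3.smooth_R ht.1

include h1 in
theorem lipschitzCoeffs : LipschitzCoeffs (coeffA hT h3 ht) (coeffB hT h3 ht) := by
  obtain ⟨κ₁, -, hκ₁⟩ := h1.lipschitz_A
  obtain ⟨κ₂, -, hκ₂⟩ := h1.lipschitz_B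
  exact ⟨κ₁, κ₂, fun s x y => ⟨hκ₁ s ⟨ht.1.trans s.2.1, s.2.2⟩ x y,
    hκ₂ s ⟨ht.1.trans s.2.1, s.2.2⟩ x y⟩⟩

theorem stateRate_ae_eq (X : C(Icc t P.T, RVec n)) (w : ControlSpace m t P.T) :
    stateRate ht.2 (coeffA hT h3 ht) (coeffB hT h3 ht) X w
      =ᵐ[(volume : Measure ℝ).restrict (Ioc t P.T)] fun r =>
        P.A r (IccExtend ht.2 X r) + P.B r (IccExtend ht.2 X r) (w r) := by
  filter_upwards [coeFn_stateRate ht.2 (coeffA hT h3 ht) (coeffB hT h3 ht) X w,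
    ae_restrict_mem measurableSet_Ioc] with r hr hmem
  rw [hr, IccExtend_of_mem _ _ (Ioc_subset_Icc_self hmem),
    IccExtend_of_mem _ _ (Ioc_subset_Icc_self hmem), IccExtend_of_mem _ _ (Ioc_subset_Icc_self hmem)]
  rfl

theorem isState_stateMap (hL : LipschitzCoeffs (coeffA hT h3 ht) (coeffB hT h3 ht)) (x : RVec n)
    (w : ControlSpace m t P.T) :
    P.IsState t x w (IccExtend ht.2 (stateMap ht.2 hL x w)) := by
  refine ⟨(continuous_iccExtend ht.2 _).continuousOn, fun s hs => ?_⟩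
  have h := congrArg (fun Z : C(Icc t P.T, RVec n) => Z ⟨s, hs⟩) (stateMap_eq ht.2 hL x w)
  rw [IccExtend_of_mem _ _ hs,
    ← intervalIntegral_congr_ae_restrict (stateRate_ae_eq hT h3 ht (stateMap ht.2 hL x w) w) hs]
  exact h

theorem IsState.eq_stateMap (hL : LipschitzCoeffs (coeffA hT h3 ht) (coeffB hT h3 ht))
    {x : RVec n} {w : ControlSpace m t P.T} {X : ℝ → RVec n} (hX : P.IsState t x w X) {s : ℝ}
    (hs : s ∈ Icc t P.T) : X s = stateMap ht.2 hL x w ⟨s, hs⟩ := by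
  set Z : C(Icc t P.T, RVec n) := ⟨fun s => X s, hX.1.domRestrict⟩ with hZ
  have key : Z = stateMap ht.2 hL x w := by
    refine _root_.eq_stateMap ht.2 hL x ?_
    ext1 s
    rw [ContinuousMap.add_apply, primitive_apply,
      intervalIntegral_congr_ae_restrict (stateRate_ae_eq hT h3 ht Z w) s.2]
    refine (hX.2 s s.2).trans (congrArg₂ (· + ·) rfl ?_)
    refine intervalIntegral.integral_congr fun r hr => ?_
    rw [uIcc_of_le s.2.1] at hr
    simp only [IccExtend_of_mem ht.2 Z (⟨hr.1, hr.2.trans s.2.2⟩ : r ∈ Icc t P.T)]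
    rfl
  rw [← key]
  rfl

/-- Uniqueness of the state makes the choice in `state` immaterial on `[t, T]`. -/
theorem state_eq_stateMap (hL : LipschitzCoeffs (coeffA hT h3 ht) (coeffB hT h3 ht))
    (x : RVec n) (w : ControlSpace m t P.T) {s : ℝ} (hs : s ∈ Icc t P.T) :
    P.state t x w s = stateMap ht.2 hL x w ⟨s, hs⟩ := by
  have hex : ∃ X, P.IsState t x w X := ⟨_, isState_stateMap hT h3 ht hL x w⟩
  have : P.IsState t x w (P.state t x w) := by
    rw [state, dif_pos hex]
    exact hex.choose_spec
  exact this.eq_stateMap hT h3 ht hL hs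

theorem J_eq_costMap (hL : LipschitzCoeffs (coeffA hT h3 ht) (coeffB hT h3 ht)) (x : RVec n) :
    P.J t x = costMap ht.2 (coeffQ hT h3 ht) (coeffS hT h3 ht) (coeffR hT h3 ht) P.G hL x := by
  ext1 w
  rw [J, costMap, integralL1_apply, intervalIntegral_congr_ae_restrict
    (coeFn_costDensity ht.2 (coeffQ hT h3 ht) (coeffS hT h3 ht) (coeffR hT h3 ht) _ w)
    (right_mem_Icc.2 ht.2), state_eq_stateMap hT h3 ht hL x w (right_mem_Icc.2 ht.2)]
  congr 1
  refine intervalIntegral.integral_congr fun r hr => ?_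
  rw [uIcc_of_le ht.2] at hr
  simp only [state_eq_stateMap hT h3 ht hL x w hr, projIcc_of_mem ht.2 hr]
  rw [add_assoc]
  rfl

end StateAndCost

/-! ### The coefficients `𝐀`, `𝐀₁`, `𝐂` as derivatives of the data. -/

section PointwiseFormulas

variable {n m : ℕ} {P : AQProblem n m}

theorem hasFDerivAt_slice {V : Type*} [NormedAddCommGroup V] [NormedSpace ℝ V] (hT : 0 < P.T)
    {f : ℝ → RVec n → V} (hf : ContDiffOn ℝ 2 (fun p : ℝ × RVec n => f p.1 p.2) P.domain) {s : ℝ}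
    (hs : s ∈ Icc 0 P.T) (x : RVec n) :
    HasFDerivAt (f s) (fderiv ℝ (f s) x) x ∧
      HasFDerivAt (fderiv ℝ (f s)) (fderiv ℝ (fderiv ℝ (f s)) x) x :=
  ⟨(C2Coeff.ofContDiffOn hT hf le_rfl).hasFDerivAt₀ ⟨s, hs⟩ x,
    (C2Coeff.ofContDiffOn hT hf le_rfl).hasFDerivAt₁ ⟨s, hs⟩ x⟩

variable (hT : 0 < P.T) (h3 : P.H3) {s : ℝ} (hs : s ∈ Icc 0 P.T)

include hT h3 hs

theorem bA_apply (x : RVec n) (u : RVec m) (h : RVec n) :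
    P.bA s x u h = fderiv ℝ (P.A s) x h + fderiv ℝ (P.B s) x h u := by
  have := ((hasFDerivAt_slice hT h3.smooth_B hs x).1.clm_apply (hasFDerivAt_const u x)).fderiv
  rw [bA, add_apply, this]
  simp

theorem inner_bA₁ (x y : RVec n) (u : RVec m) (h : RVec n) :
    ⟪P.bA₁ s x y u h, h⟫_ℝ = ⟪y, fderiv ℝ (fderiv ℝ (P.A s)) x h h⟫_ℝ
      + fderiv ℝ (fderiv ℝ (P.Q s)) x h h
      + 1 / 2 * ⟪fderiv ℝ (fderiv ℝ (P.R s)) x h h u, u⟫_ℝ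
      + (⟪y, fderiv ℝ (fderiv ℝ (P.B s)) x h h u⟫_ℝ
        + ⟪fderiv ℝ (fderiv ℝ (P.S s)) x h h, u⟫_ℝ) := by
  have eA := inner_fderiv_gradient_clm_comp (fun z => (hasFDerivAt_slice hT h3.smooth_A hs z).1)
    (hasFDerivAt_slice hT h3.smooth_A hs x).2 (innerSL ℝ y) h h
  have eQ := inner_fderiv_gradient_clm_comp (fun z => (hasFDerivAt_slice hT h3.smooth_Q hs z).1)
    (hasFDerivAt_slice hT h3.smooth_Q hs x).2 (ContinuousLinearMap.id ℝ ℝ) h h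
  have eR := inner_fderiv_gradient_clm_comp (fun z => (hasFDerivAt_slice hT h3.smooth_R hs z).1)
    (hasFDerivAt_slice hT h3.smooth_R hs x).2
    (((innerSL ℝ).flip u).comp (ContinuousLinearMap.apply ℝ (RVec m) u)) h h
  have eB := inner_fderiv_gradient_clm_comp (fun z => (hasFDerivAt_slice hT h3.smooth_B hs z).1)
    (hasFDerivAt_slice hT h3.smooth_B hs x).2
    ((innerSL ℝ y).comp (ContinuousLinearMap.apply ℝ (RVec n) u)) h h
  have eS := inner_fderiv_gradient_clm_comp (fun z => (hasFDerivAt_slice hT h3.smooth_S hs z).1)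
    (hasFDerivAt_slice hT h3.smooth_S hs x).2 ((innerSL ℝ).flip u) h h
  simp only [bA₁, add_apply, smul_apply, inner_add_left, real_inner_smul_left]
  refine congrArg₂ (· + ·) (congrArg₂ (· + ·) (congrArg₂ (· + ·) eA eQ) (congrArg₂ (· * ·) rfl eR))
    (congrArg₂ (· + ·) eB eS)

theorem inner_bC (x y : RVec n) (u : RVec m) (h : RVec n) (v : RVec m) :
    ⟪P.bC s x y u h, v⟫_ℝ = ⟪fderiv ℝ (P.R s) x h u, v⟫_ℝ + ⟪fderiv ℝ (P.S s) x h, v⟫_ℝ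
      + ⟪y, fderiv ℝ (P.B s) x h v⟫_ℝ := by
  have eR := ((hasFDerivAt_slice hT h3.smooth_R hs x).1.clm_apply (hasFDerivAt_const u x)).fderiv
  have eB : HasFDerivAt (fun z => (P.B s z).adjoint y)
      (((rieszCLM (RVec m)).comp (ContinuousLinearMap.compL ℝ _ _ ℝ (innerSL ℝ y))).comp
        (fderiv ℝ (P.B s) x)) x := by
    have h5 := ((rieszCLM (RVec m)).comp
      (ContinuousLinearMap.compL ℝ (RVec m) (RVec n) ℝ (innerSL ℝ y))).hasFDerivAt.comp x
        (hasFDerivAt_slice hT h3.smooth_B hs x).1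
    refine h5.congr_of_eventuallyEq (Filter.Eventually.of_forall fun z => ?_)
    exact adjoint_apply_eq_rieszCLM (P.B s z) y
  simp only [bC, add_apply, inner_add_left, eR, eB.fderiv]
  refine congrArg₂ (· + ·) (congrArg₂ (· + ·) (by simp) rfl) ?_
  exact inner_rieszCLM _ _

/-- The adjoint rate is designed for this splitting: `y` paired with the linearized state rate, plus
the first-order variation of the running cost in the state. -/
theorem inner_adjointRate (x y : RVec n) (u : RVec m) (h : RVec n) :
    ⟪(P.bA s x u).adjoint y + gradient (P.Q s) x + (fderiv ℝ (P.S s) x).adjoint u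
        + (1 / 2 : ℝ) • gradient (fun z => ⟪P.R s z u, u⟫_ℝ) x, h⟫_ℝ =
      ⟪y, fderiv ℝ (P.A s) x h + fderiv ℝ (P.B s) x h u⟫_ℝ
        + (fderiv ℝ (P.Q s) x h + ⟪fderiv ℝ (P.S s) x h, u⟫_ℝ
          + 1 / 2 * ⟪fderiv ℝ (P.R s) x h u, u⟫_ℝ) := by
  have eQ : ⟪gradient (P.Q s) x, h⟫_ℝ = fderiv ℝ (P.Q s) x h := inner_rieszCLM _ _
  have eR := inner_gradient_clm_comp (hasFDerivAt_slice hT h3.smooth_R hs x).1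
    (((innerSL ℝ).flip u).comp (ContinuousLinearMap.apply ℝ (RVec m) u)) h
  have eR' : ⟪gradient (fun z => ⟪P.R s z u, u⟫_ℝ) x, h⟫_ℝ
    = ⟪fderiv ℝ (P.R s) x h u, u⟫_ℝ := eR
  rw [inner_add_left, inner_add_left, inner_add_left, real_inner_smul_left,
    ContinuousLinearMap.adjoint_inner_left, ContinuousLinearMap.adjoint_inner_left,
    bA_apply hT h3 hs, eQ, eR', real_inner_comm _ u]
  ring

/-- Differentiating the symmetry of `R s z` in `z` keeps it symmetric. This merges the two cross
terms with `R_x` in the second variation. -/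
theorem inner_fderiv_R_comm (h2 : P.H2) (x h : RVec n) (v w : RVec m) :
    ⟪fderiv ℝ (P.R s) x h v, w⟫_ℝ = ⟪fderiv ℝ (P.R s) x h w, v⟫_ℝ := by
  have e := (hasFDerivAt_slice hT h3.smooth_R hs x).1
  have e1 := (((innerSL ℝ).flip w).comp (ContinuousLinearMap.apply ℝ (RVec m) v)).hasFDerivAt.comp
    x e
  have e2 := (((innerSL ℝ).flip v).comp (ContinuousLinearMap.apply ℝ (RVec m) w)).hasFDerivAt.comp
    x e
  have e3 : (((innerSL ℝ).flip w).comp (ContinuousLinearMap.apply ℝ (RVec m) v)) ∘ P.R s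
      = (((innerSL ℝ).flip v).comp (ContinuousLinearMap.apply ℝ (RVec m) w)) ∘ P.R s := by
    ext1 z
    change ⟪P.R s z v, w⟫_ℝ = ⟪P.R s z w, v⟫_ℝ
    rw [← ContinuousLinearMap.adjoint_inner_right, h2.symmetric_R s hs z, real_inner_comm]
  rw [e3] at e1
  exact congrArg (fun L : RVec n →L[ℝ] ℝ => L h) (e1.unique e2)

end PointwiseFormulas

end AQProblem

/-! ### Bilinear maps used for measurability and integrability. -/

section Auxiliary

theorem intervalIntegrable_of_ae_eq {E : Type*} [NormedAddCommGroup E] {a b : ℝ} (hab : a ≤ b)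
    {f : Lp E 1 ((volume : Measure ℝ).restrict (Ioc a b))} {φ : ℝ → E}
    (h : f =ᵐ[(volume : Measure ℝ).restrict (Ioc a b)] φ) : IntervalIntegrable φ volume a b := by
  rw [intervalIntegrable_iff_integrableOn_Ioc_of_le hab]
  exact (L1.integrable_coeFn f).congr h

/-- Evaluation of the adjoint, as a bounded bilinear map. -/
def adjointBilin (E F : Type*) [NormedAddCommGroup E] [InnerProductSpace ℝ E] [CompleteSpace E]
    [NormedAddCommGroup F] [InnerProductSpace ℝ F] [CompleteSpace F] :
    (E →L[ℝ] F) →L[ℝ] F →L[ℝ] E :=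
  ((ContinuousLinearMap.compL ℝ (E →L[ℝ] F) (E →L[ℝ] ℝ) E (rieszCLM E)).comp
    ((ContinuousLinearMap.compL ℝ E F ℝ).comp (innerSL ℝ))).flip

theorem adjointBilin_apply {E F : Type*} [NormedAddCommGroup E] [InnerProductSpace ℝ E]
    [CompleteSpace E] [NormedAddCommGroup F] [InnerProductSpace ℝ F] [CompleteSpace F]
    (M : E →L[ℝ] F) (y : F) : adjointBilin E F M y = M.adjoint y :=
  (adjoint_apply_eq_rieszCLM M y).symm

/-- The interchange of the arguments of bilinear maps, as a bounded bilinear map. -/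
def flipBilin (E F G : Type*) [NormedAddCommGroup E] [NormedSpace ℝ E] [NormedAddCommGroup F]
    [NormedSpace ℝ F] [NormedAddCommGroup G] [NormedSpace ℝ G] :
    (E →L[ℝ] F →L[ℝ] G) →L[ℝ] F →L[ℝ] E →L[ℝ] G :=
  (ContinuousLinearMap.flipₗᵢ ℝ E F G).toContinuousLinearEquiv.toContinuousLinearMap

theorem coeFn_holderL_ae_eq {E F G : Type*} [NormedAddCommGroup E] [NormedSpace ℝ E]
    [NormedAddCommGroup F] [NormedSpace ℝ F] [NormedAddCommGroup G] [NormedSpace ℝ G]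
    {μ : Measure ℝ} (β : E →L[ℝ] F →L[ℝ] G) {f : Lp E 2 μ} {g : Lp F 2 μ} {φ : ℝ → E} {γ : ℝ → F}
    (hf : f =ᵐ[μ] φ) (hg : g =ᵐ[μ] γ) :
    β.holderL μ 2 2 1 f g =ᵐ[μ] fun r => β (φ r) (γ r) := by
  filter_upwards [β.coeFn_holder (r := 1) f g, hf, hg] with r h1 h2 h3
  rw [← h2, ← h3]
  exact h1

end Auxiliary

/-! ### Integrability along the trajectory and the first variation of the state. -/

namespace AQProblem

section SecondVariation

variable {n m : ℕ} {P : AQProblem n m} (hT : 0 < P.T) (h3 : P.H3) {t : ℝ} (ht : t ∈ Icc 0 P.T)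
  {Z : C(Icc t P.T, RVec n)} {X : ℝ → RVec n} (hXZ : ∀ s (hs : s ∈ Icc t P.T), X s = Z ⟨s, hs⟩)

include hT h3 ht hXZ

/-- Along `X` the matrix `𝐀` is a continuous function plus a continuous one times `u`, hence square
integrable. -/
theorem intervalIntegrable_bA (u : ControlSpace m t P.T) :
    IntervalIntegrable (fun r => P.bA r (X r) (u r)) volume t P.T ∧
      IntervalIntegrable (fun r => ‖P.bA r (X r) (u r)‖ ^ 2) volume t P.T := by
  have hM := Lp_coeFn_add_ae_eq (coeFn_continuousToLp ht.2 2 (superpose (coeffA hT h3 ht).f₁ Z))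
    (coeFn_mulL2 ht.2 (flipBilin (RVec n) (RVec m) (RVec n)) (superpose (coeffB hT h3 ht).f₁ Z) u)
  set M : Lp (RMat n n) 2 ((volume : Measure ℝ).restrict (Ioc t P.T)) :=
    continuousToLp ht.2 2 (superpose (coeffA hT h3 ht).f₁ Z)
      + mulL2 ht.2 (flipBilin (RVec n) (RVec m) (RVec n)) (superpose (coeffB hT h3 ht).f₁ Z) u
  have hM' : M =ᵐ[(volume : Measure ℝ).restrict (Ioc t P.T)] fun r => P.bA r (X r) (u r) := by
    filter_upwards [hM, ae_restrict_mem measurableSet_Ioc] with r hr hmem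
    have hmem' := Ioc_subset_Icc_self hmem
    rw [hr, IccExtend_of_mem _ _ hmem', IccExtend_of_mem _ _ hmem', hXZ r hmem']
    ext1 h
    rw [bA_apply hT h3 ⟨ht.1.trans hmem'.1, hmem'.2⟩]
    rfl
  constructor
  · rw [intervalIntegrable_iff_integrableOn_Ioc_of_le ht.2]
    exact ((Lp.memLp M).integrable one_le_two).congr hM'
  · have := intervalIntegrable_norm_sq ht.2 M
    rw [intervalIntegrable_iff_integrableOn_Ioc_of_le ht.2] at this ⊢
    refine this.congr ?_
    filter_upwards [hM'] with r hr
    rw [hr]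

theorem intervalIntegrable_adjointRate (u : ControlSpace m t P.T) {Y : ℝ → RVec n}
    (hY : ContinuousOn Y (Icc t P.T)) :
    IntervalIntegrable (fun r => (P.bA r (X r) (u r)).adjoint (Y r) + gradient (P.Q r) (X r)
        + (fderiv ℝ (P.S r) (X r)).adjoint (u r)
        + (1 / 2 : ℝ) • gradient (fun z => ⟪P.R r z (u r), u r⟫_ℝ) (X r)) volume t P.T := by
  have e1 := intervalIntegrable_bilin_left (adjointBilin (RVec n) (RVec n)) ht.2
    (intervalIntegrable_bA hT h3 ht hXZ u).1 hY
  simp only [adjointBilin_apply] at e1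
  have e2 : IntervalIntegrable (fun r => gradient (P.Q r) (X r)) volume t P.T := by
    refine intervalIntegrable_of_ae_eq ht.2 (f := continuousToLp ht.2 1
      (⟨fun s => rieszCLM (RVec n) ((coeffQ hT h3 ht).f₁ (s, Z s)),
      (rieszCLM (RVec n)).continuous.comp (superpose (coeffQ hT h3 ht).f₁ Z).continuous⟩ :
        C(Icc t P.T, RVec n))) ?_
    filter_upwards [coeFn_continuousToLp ht.2 1 (⟨fun s => rieszCLM (RVec n)
        ((coeffQ hT h3 ht).f₁ (s, Z s)), (rieszCLM (RVec n)).continuous.comp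
          (superpose (coeffQ hT h3 ht).f₁ Z).continuous⟩ : C(Icc t P.T, RVec n)),
      ae_restrict_mem measurableSet_Ioc] with r hr hmem
    have hmem' := Ioc_subset_Icc_self hmem
    rw [hr, IccExtend_of_mem _ _ hmem', hXZ r hmem']
    rfl
  have e3 : IntervalIntegrable (fun r => (fderiv ℝ (P.S r) (X r)).adjoint (u r)) volume t P.T := by
    refine intervalIntegrable_of_ae_eq ht.2 (f := mulL1 ht.2 (adjointBilin (RVec n) (RVec m))
      (superpose (coeffS hT h3 ht).f₁ Z) u) ?_
    filter_upwards [coeFn_mulL1 ht.2 (adjointBilin (RVec n) (RVec m))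
      (superpose (coeffS hT h3 ht).f₁ Z) u, ae_restrict_mem measurableSet_Ioc] with r hr hmem
    have hmem' := Ioc_subset_Icc_self hmem
    rw [hr, IccExtend_of_mem _ _ hmem', hXZ r hmem', adjointBilin_apply]
    rfl
  have e4 : IntervalIntegrable (fun r => gradient (fun z => ⟪P.R r z (u r), u r⟫_ℝ) (X r))
      volume t P.T := by
    -- This term is quadratic in `u`, so it is a product of two `L²` factors: `R_x` applied to `u`,
    -- and `u` itself.
    have h4 := coeFn_holderL_ae_eq (adjointBilin (RVec n) (RVec m))
      (coeFn_mulL2 ht.2 (flipBilin (RVec n) (RVec m) (RVec m)) (superpose (coeffR hT h3 ht).f₁ Z) u)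
      (Filter.EventuallyEq.refl _ u)
    refine intervalIntegrable_of_ae_eq ht.2 (h4.trans ?_)
    filter_upwards [ae_restrict_mem measurableSet_Ioc] with r hmem
    have hmem' := Ioc_subset_Icc_self hmem
    rw [IccExtend_of_mem _ _ hmem', hXZ r hmem', adjointBilin_apply]
    refine ext_inner_right ℝ fun h => ?_
    rw [ContinuousLinearMap.adjoint_inner_left]
    have h5 := inner_gradient_clm_comp
      (hasFDerivAt_slice hT h3.smooth_R ⟨ht.1.trans hmem'.1, hmem'.2⟩ (Z ⟨r, hmem'⟩)).1
      (((innerSL ℝ).flip (u r)).comp (ContinuousLinearMap.apply ℝ (RVec m) (u r))) h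
    rw [real_inner_comm]
    exact h5.symm
  exact ((e1.add e2).add e3).add (e4.smul (1 / 2 : ℝ))

theorem intervalIntegrable_R (v : ControlSpace m t P.T) :
    IntervalIntegrable (fun s => ⟪P.R s (X s) (v s), v s⟫_ℝ) volume t P.T := by
  have h := coeFn_innerL1 (coeFn_mulL2 ht.2 (ContinuousLinearMap.id ℝ (RMat m m))
    (superpose (coeffR hT h3 ht).f₀ Z) v) (Filter.EventuallyEq.refl _ v)
  refine intervalIntegrable_of_ae_eq ht.2 (h.trans ?_)
  filter_upwards [ae_restrict_mem measurableSet_Ioc] with r hmem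
  have hmem' := Ioc_subset_Icc_self hmem
  rw [IccExtend_of_mem _ _ hmem', hXZ r hmem']
  rfl

theorem intervalIntegrable_bC (u v : ControlSpace m t P.T) {Y : ℝ → RVec n}
    (hY : ContinuousOn Y (Icc t P.T)) (X₁ : C(Icc t P.T, RVec n)) :
    IntervalIntegrable (fun s => ⟪P.bC s (X s) (Y s) (u s) (IccExtend ht.2 X₁ s), v s⟫_ℝ)
      volume t P.T := by
  have h1 := Lp_coeFn_add_ae_eq
    (coeFn_innerL1 (coeFn_mulL2 ht.2 (ContinuousLinearMap.id ℝ (RMat m m))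
      (pointwiseApply (superpose (coeffR hT h3 ht).f₁ Z) X₁) u) (Filter.EventuallyEq.refl _ v))
    (coeFn_mulL1 ht.2 (innerSL ℝ) (pointwiseApply (superpose (coeffS hT h3 ht).f₁ Z) X₁) v)
  have h2 := intervalIntegrable_bilin_left (innerSL (E := RVec n) ℝ).flip ht.2
    (intervalIntegrable_of_ae_eq ht.2 (coeFn_mulL1 ht.2 (ContinuousLinearMap.id ℝ (RMat n m))
      (pointwiseApply (superpose (coeffB hT h3 ht).f₁ Z) X₁) v)) hY
  have h3' := (intervalIntegrable_of_ae_eq ht.2 h1).add h2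
  rw [intervalIntegrable_iff_integrableOn_Ioc_of_le ht.2] at h3' ⊢
  refine h3'.congr ?_
  filter_upwards [ae_restrict_mem measurableSet_Ioc] with r hmem
  have hmem' := Ioc_subset_Icc_self hmem
  rw [inner_bC hT h3 ⟨ht.1.trans hmem'.1, hmem'.2⟩, hXZ r hmem', IccExtend_of_mem _ _ hmem',
    IccExtend_of_mem _ _ hmem', IccExtend_of_mem _ _ hmem', IccExtend_of_mem _ _ hmem']
  rfl

/-- Pointwise, the equation of `X₁` is `Ẋ₁ = 𝐀X₁ + Bv` with `X₁(t) = 0`, and variation of constants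
solves it. -/
theorem linResponse_eq {u v : ControlSpace m t P.T} {Φ : ℝ → ℝ → RMat n n}
    (hΦ : P.IsFundamentalMatrix t (fun s => P.bA s (X s) (u s)) Φ) {X₁ : C(Icc t P.T, RVec n)}
    (hX₁ : X₁ = primitive ht.2 (linearRate ht.2 (coeffA hT h3 ht) (coeffB hT h3 ht) Z u X₁
      + mulL1 ht.2 (ContinuousLinearMap.id ℝ (RMat n m)) (superpose (coeffB hT h3 ht).f₀ Z) v))
    {s : ℝ} (hs : s ∈ Icc t P.T) : P.linResponse t X Φ v s = X₁ ⟨s, hs⟩ := by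
  obtain ⟨hM, hM2⟩ := intervalIntegrable_bA hT h3 ht hXZ u
  obtain ⟨Ψ, W, -, -, -, hvar⟩ := exists_factor_fundamental ht.2 hM hM2 hΦ
  have hg : mulL1 ht.2 (ContinuousLinearMap.id ℝ (RMat n m)) (superpose (coeffB hT h3 ht).f₀ Z) v
      =ᵐ[(volume : Measure ℝ).restrict (Ioc t P.T)] fun r => P.B r (X r) (v r) := by
    filter_upwards [coeFn_mulL1 ht.2 (ContinuousLinearMap.id ℝ (RMat n m))
      (superpose (coeffB hT h3 ht).f₀ Z) v, ae_restrict_mem measurableSet_Ioc] with r hr hmem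
    have hmem' := Ioc_subset_Icc_self hmem
    rw [hr, hXZ r hmem', IccExtend_of_mem _ _ hmem']
    rfl
  have hrate : linearRate ht.2 (coeffA hT h3 ht) (coeffB hT h3 ht) Z u X₁
      =ᵐ[(volume : Measure ℝ).restrict (Ioc t P.T)]
        fun r => P.bA r (X r) (u r) (IccExtend ht.2 X₁ r) := by
    filter_upwards [coeFn_linearRate ht.2 (coeffA hT h3 ht) (coeffB hT h3 ht) Z u X₁,
      ae_restrict_mem measurableSet_Ioc] with r hr hmem
    have hmem' := Ioc_subset_Icc_self hmem
    rw [hr, bA_apply hT h3 ⟨ht.1.trans hmem'.1, hmem'.2⟩, hXZ r hmem', IccExtend_of_mem _ _ hmem',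
      IccExtend_of_mem _ _ hmem', IccExtend_of_mem _ _ hmem']
    rfl
  have key := hvar (IccExtend ht.2 X₁) (fun r => P.B r (X r) (v r))
    (continuous_iccExtend ht.2 X₁).continuousOn (intervalIntegrable_of_ae_eq ht.2 hg)
    (fun s hs => by
      rw [← intervalIntegral_congr_ae_restrict (Lp_coeFn_add_ae_eq hrate hg) hs,
        IccExtend_of_mem _ _ hs]
      exact congrArg (fun F : C(Icc t P.T, RVec n) => F ⟨s, hs⟩) hX₁) s hs
  rw [IccExtend_of_mem _ _ hs] at key
  exact key.symm

end SecondVariation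

end AQProblem

/-! ### The formula for the second derivative of the cost. -/

namespace AQProblem

section SecondVariationFormula

variable {n m : ℕ} {P : AQProblem n m} (hT : 0 < P.T) (h1 : P.H1) (h2 : P.H2) (h3 : P.H3) {t : ℝ}
  (ht : t ∈ Icc 0 P.T)

include hT h1 h3 ht

theorem contDiff_J (x : RVec n) : ContDiff ℝ 2 (P.J t x) := by
  rw [J_eq_costMap hT h3 ht (lipschitzCoeffs hT h1 h3 ht) x]
  exact contDiff_costMap _ _ _ _ _ _ _ h3.smooth_G

include h2

/-- Duality replaces the terms linear in the second variation `X₂` by the pairing of `Y` with the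
quadratic source of its equation; the rest is collected pointwise. -/
theorem second_derivative_J {x : RVec n} {u : ControlSpace m t P.T} {X Y : ℝ → RVec n}
    (hX : P.IsState t x u X) (hY : P.IsAdjointState t u X Y) {Φ : ℝ → ℝ → RMat n n}
    (hΦ : P.IsFundamentalMatrix t (fun s => P.bA s (X s) (u s)) Φ) (v : ControlSpace m t P.T) :
    IntervalIntegrable (fun s => ⟪P.R s (X s) (v s), v s⟫_ℝ) volume t P.T ∧
    IntervalIntegrable (fun s => ⟪P.bA₁ s (X s) (Y s) (u s) (P.linResponse t X Φ v s),
      P.linResponse t X Φ v s⟫_ℝ) volume t P.T ∧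
    IntervalIntegrable (fun s => ⟪P.bC s (X s) (Y s) (u s) (P.linResponse t X Φ v s), v s⟫_ℝ)
      volume t P.T ∧
    fderiv ℝ (fderiv ℝ (P.J t x)) u v v =
      (∫ s in t..P.T, ⟪P.R s (X s) (v s), v s⟫_ℝ)
      + ⟪hessian P.G (X P.T) (P.linResponse t X Φ v P.T), P.linResponse t X Φ v P.T⟫_ℝ
      + (∫ s in t..P.T, ⟪P.bA₁ s (X s) (Y s) (u s) (P.linResponse t X Φ v s),
          P.linResponse t X Φ v s⟫_ℝ)
      + 2 * ∫ s in t..P.T, ⟪P.bC s (X s) (Y s) (u s) (P.linResponse t X Φ v s), v s⟫_ℝ := by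
  have hL := lipschitzCoeffs hT h1 h3 ht
  have htT := ht.2
  obtain ⟨X₁, X₂, hjet, hX₁, hX₂⟩ := stateMap_hasJet2 htT hL x u v
  have hXZ : ∀ s (hs : s ∈ Icc t P.T), X s = stateMap htT hL x u ⟨s, hs⟩ :=
    fun s hs => hX.eq_stateMap hT h3 ht hL hs
  have hlin : ∀ s (hs : s ∈ Icc t P.T), P.linResponse t X Φ v s = X₁ ⟨s, hs⟩ :=
    fun s hs => linResponse_eq hT h3 ht hXZ hΦ hX₁ hs
  have hT' : P.T ∈ Icc t P.T := right_mem_Icc.2 htT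
  -- the terms of the formula are integrable
  have iR := intervalIntegrable_R hT h3 ht hXZ v
  have iC : IntervalIntegrable (fun s => ⟪P.bC s (X s) (Y s) (u s) (P.linResponse t X Φ v s), v s⟫_ℝ)
      volume t P.T := by
    have := intervalIntegrable_bC hT h3 ht hXZ u v hY.1 X₁
    rw [intervalIntegrable_iff_integrableOn_Ioc_of_le htT] at this ⊢
    refine this.congr ?_
    filter_upwards [ae_restrict_mem measurableSet_Ioc] with r hmem
    have hmem' := Ioc_subset_Icc_self hmem
    rw [hlin r hmem', IccExtend_of_mem _ _ hmem']
  obtain ⟨icost, hcost⟩ := costMap_second_derivative htT (coeffQ hT h3 ht) (coeffS hT h3 ht)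
    (coeffR hT h3 ht) P.G hL x h3.smooth_G u v hjet
  have hf := coeFn_stateRate₂ htT (coeffA hT h3 ht) (coeffB hT h3 ht) (stateMap htT hL x u) u X₁ v
  have hq := Lp_coeFn_add_ae_eq
    (coeFn_continuousToLp htT 1
      (pointwiseApply (superpose (coeffQ hT h3 ht).f₁ (stateMap htT hL x u)) X₂))
    (Lp_coeFn_add_ae_eq
      (coeFn_mulL1 htT (innerSL ℝ)
        (pointwiseApply (superpose (coeffS hT h3 ht).f₁ (stateMap htT hL x u)) X₂) u)
      (Lp_coeFn_smul_ae_eq (1 / 2) (coeFn_innerL1 (coeFn_mulL2 htT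
        (ContinuousLinearMap.id ℝ (RMat m m))
        (pointwiseApply (superpose (coeffR hT h3 ht).f₁ (stateMap htT hL x u)) X₂) u)
        (Filter.EventuallyEq.refl _ u))))
  -- The part of the second variation of the running cost that contains `X₂`.
  set q : ℝ → ℝ := fun r => fderiv ℝ (P.Q r) (X r) (IccExtend htT X₂ r)
    + ⟪fderiv ℝ (P.S r) (X r) (IccExtend htT X₂ r), u r⟫_ℝ
    + 1 / 2 * ⟪fderiv ℝ (P.R r) (X r) (IccExtend htT X₂ r) (u r), u r⟫_ℝ with hqdef
  have iq : IntervalIntegrable q volume t P.T := by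
    refine intervalIntegrable_of_ae_eq htT (hq.trans ?_)
    filter_upwards [ae_restrict_mem measurableSet_Ioc] with r hmem
    have hmem' := Ioc_subset_Icc_self hmem
    simp only [hqdef, hXZ r hmem', IccExtend_of_mem _ _ hmem']
    rw [add_assoc]
    rfl
  have iY : IntervalIntegrable (fun r => ⟪Y r, stateRate₂ htT (coeffA hT h3 ht) (coeffB hT h3 ht)
      (stateMap htT hL x u) u X₁ v r⟫_ℝ) volume t P.T :=
    intervalIntegrable_bilin_left (innerSL (E := RVec n) ℝ).flip htT
      (intervalIntegrable_coeFn htT _) hY.1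
  -- elimination of the second variation of the state by duality
  have hdual := inner_adjoint_terminal htT (coeffA hT h3 ht) (coeffB hT h3 ht) hX₂
    (intervalIntegrable_adjointRate hT h3 ht hXZ u hY.1) hY.2 (q := q) (by
      filter_upwards [ae_restrict_mem measurableSet_Ioc] with r hmem
      have hmem' := Ioc_subset_Icc_self hmem
      rw [inner_adjointRate hT h3 ⟨ht.1.trans hmem'.1, hmem'.2⟩, projIcc_of_mem htT hmem']
      simp only [hqdef, hXZ r hmem', IccExtend_of_mem htT X₂ hmem']
      rfl)
  have hGX₂ : fderiv ℝ P.G (stateMap htT hL x u ⟨P.T, hT'⟩) (X₂ ⟨P.T, hT'⟩)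
      = ⟪gradient P.G (X P.T), X₂ ⟨P.T, hT'⟩⟫_ℝ := by
    rw [hXZ P.T hT', gradient_eq_rieszCLM, inner_rieszCLM]
  -- Subtracting `q` cancels `X₂`. The mixed terms with `R_x`, `S_x` and, through `Y`, `B_x` add up
  -- to `2⟨𝐂X₁, v⟩`, and the second derivatives to `⟨𝐀₁X₁, X₁⟩`.
  have hpt : ∀ᵐ r ∂(volume : Measure ℝ).restrict (Ioc t P.T),
      costRate₂ htT (coeffQ hT h3 ht) (coeffS hT h3 ht) (coeffR hT h3 ht) (stateMap htT hL x u) u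
        X₁ X₂ v r + (⟪Y r, stateRate₂ htT (coeffA hT h3 ht) (coeffB hT h3 ht)
          (stateMap htT hL x u) u X₁ v r⟫_ℝ - q r) =
      (⟪P.R r (X r) (v r), v r⟫_ℝ + 2 * ⟪P.bC r (X r) (Y r) (u r) (P.linResponse t X Φ v r), v r⟫_ℝ)
        + ⟪P.bA₁ r (X r) (Y r) (u r) (P.linResponse t X Φ v r), P.linResponse t X Φ v r⟫_ℝ := by
    filter_upwards [hf, ae_restrict_mem measurableSet_Ioc] with r hr hmem
    have hmem' := Ioc_subset_Icc_self hmem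
    have h0 : r ∈ Icc 0 P.T := ⟨ht.1.trans hmem'.1, hmem'.2⟩
    rw [hr, inner_bA₁ hT h3 h0, inner_bC hT h3 h0]
    have hsymm := inner_fderiv_R_comm hT h3 h0 h2 (X r) (P.linResponse t X Φ v r) (v r) (u r)
    simp only [hqdef, costRate₂, projIcc_of_mem htT hmem', IccExtend_of_mem htT X₂ hmem',
      ← hlin r hmem']
    change (fderiv ℝ (fderiv ℝ (P.Q r)) (stateMap htT hL x u ⟨r, hmem'⟩) _ _
      + fderiv ℝ (P.Q r) (stateMap htT hL x u ⟨r, hmem'⟩) _)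
      + ((⟪fderiv ℝ (fderiv ℝ (P.S r)) (stateMap htT hL x u ⟨r, hmem'⟩) _ _
        + fderiv ℝ (P.S r) (stateMap htT hL x u ⟨r, hmem'⟩) _, _⟫_ℝ
        + (2 : ℝ) • ⟪fderiv ℝ (P.S r) (stateMap htT hL x u ⟨r, hmem'⟩) _, v r⟫_ℝ)
      + (1 / 2 : ℝ) • (⟪(fderiv ℝ (fderiv ℝ (P.R r)) (stateMap htT hL x u ⟨r, hmem'⟩) _ _
        + fderiv ℝ (P.R r) (stateMap htT hL x u ⟨r, hmem'⟩) _) (u r)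
        + (2 : ℝ) • fderiv ℝ (P.R r) (stateMap htT hL x u ⟨r, hmem'⟩) _ (v r), u r⟫_ℝ
        + (2 : ℝ) • ⟪fderiv ℝ (P.R r) (stateMap htT hL x u ⟨r, hmem'⟩) _ (u r)
          + P.R r (stateMap htT hL x u ⟨r, hmem'⟩) (v r), v r⟫_ℝ))
      + (⟪Y r, fderiv ℝ (fderiv ℝ (P.A r)) (stateMap htT hL x u ⟨r, hmem'⟩) _ _
        + (fderiv ℝ (fderiv ℝ (P.B r)) (stateMap htT hL x u ⟨r, hmem'⟩) _ _ (u r)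
          + (2 : ℝ) • fderiv ℝ (P.B r) (stateMap htT hL x u ⟨r, hmem'⟩) _ (v r))⟫_ℝ - _) = _
    rw [← hXZ r hmem']
    simp only [add_apply, inner_add_left, inner_add_right, real_inner_smul_left,
      real_inner_smul_right, smul_eq_mul, hsymm]
    ring
  -- Every other term of `hpt` is integrable, so this one is too.
  have iA : IntervalIntegrable (fun s => ⟪P.bA₁ s (X s) (Y s) (u s) (P.linResponse t X Φ v s),
      P.linResponse t X Φ v s⟫_ℝ) volume t P.T := by
    have h := (icost.add (iY.sub iq)).sub (iR.add (iC.const_mul 2))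
    rw [intervalIntegrable_iff_integrableOn_Ioc_of_le htT] at h ⊢
    refine h.congr ?_
    filter_upwards [hpt] with r hr
    exact sub_eq_iff_eq_add'.2 hr
  refine ⟨iR, iA, iC, ?_⟩
  have hess : ⟪hessian P.G (X P.T) (P.linResponse t X Φ v P.T), P.linResponse t X Φ v P.T⟫_ℝ =
      fderiv ℝ (fderiv ℝ P.G) (stateMap htT hL x u ⟨P.T, hT'⟩) (X₁ ⟨P.T, hT'⟩)
        (X₁ ⟨P.T, hT'⟩) := by
    rw [hlin P.T hT', hXZ P.T hT']
    exact inner_fderiv_gradient h3.smooth_G _ _ _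
  have hsum := intervalIntegral_congr_ae_restrict hpt hT'
  rw [intervalIntegral.integral_add icost (iY.sub iq),
    intervalIntegral.integral_add (iR.add (iC.const_mul 2)) iA,
    intervalIntegral.integral_add iR (iC.const_mul 2), intervalIntegral.integral_const_mul,
    ← hdual] at hsum
  rw [J_eq_costMap hT h3 ht hL x, hcost, hGX₂, hess]
  linarith

end SecondVariationFormula

end AQProblem

/-! ### Quadratic forms of linear integrals of a square integrable function. -/

section HilbertSchmidt

variable {V E : Type*} [NormedAddCommGroup V] [InnerProductSpace ℝ V] [CompleteSpace V]
  [NormedAddCommGroup E] [InnerProductSpace ℝ E] [CompleteSpace E] {a b : ℝ}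

theorem Continuous.memLp_restrict_Ioc {F : Type*} [NormedAddCommGroup F] {f : ℝ → F}
    (hf : Continuous f) (p : ENNReal) :
    MemLp f p ((volume : Measure ℝ).restrict (Ioc a b)) := by
  obtain ⟨C, hC⟩ := (isCompact_Icc (a := a) (b := b)).exists_bound_of_continuousOn hf.continuousOn
  refine MemLp.of_bound hf.aestronglyMeasurable C ?_
  filter_upwards [ae_restrict_mem measurableSet_Ioc] with r hr
  exact hC r (Ioc_subset_Icc_self hr)

theorem intervalIntegral_mul_norm_le (hab : a ≤ b) {f : ℝ → ℝ} (hf : Continuous f)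
    (hf0 : ∀ r, 0 ≤ f r) {v : ℝ → V} (hv : MemLp v 2 ((volume : Measure ℝ).restrict (Ioc a b))) :
    ∫ r in a..b, f r * ‖v r‖ ≤ √(∫ r in a..b, f r ^ 2) * √(∫ r in a..b, ‖v r‖ ^ 2) := by
  simp only [intervalIntegral.integral_of_le hab]
  have h2 : ENNReal.ofReal 2 = 2 := by simp
  have h := integral_mul_le_Lp_mul_Lq_of_nonneg (μ := (volume : Measure ℝ).restrict (Ioc a b))
    Real.HolderConjugate.two_two (f := f) (g := fun r => ‖v r‖) (Filter.Eventually.of_forall hf0)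
    (Filter.Eventually.of_forall fun r => norm_nonneg _) (by rw [h2]; exact hf.memLp_restrict_Ioc 2)
    (by rw [h2]; exact hv.norm)
  simpa only [Real.sqrt_eq_rpow, Real.rpow_two] using h

theorem intervalIntegrable_clm_apply_of_memLp {L : ℝ → V →L[ℝ] E} (hL : Continuous L) (hab : a ≤ b) {v : ℝ → V}
    (hv : MemLp v 2 ((volume : Measure ℝ).restrict (Ioc a b))) :
    IntervalIntegrable (fun r => L r (v r)) volume a b :=
  intervalIntegrable_bilin_left (ContinuousLinearMap.id ℝ (V →L[ℝ] E)).flip hab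
    (by rw [intervalIntegrable_iff_integrableOn_Ioc_of_le hab]; exact hv.integrable one_le_two)
    hL.continuousOn

/-- A quadratic form of `∫ L v` is bounded through the Hilbert–Schmidt norm of its kernel. -/
theorem inner_integral_le_hilbertSchmidt {L : ℝ → V →L[ℝ] E} (hL : Continuous L) (hab : a ≤ b)
    (M : E →L[ℝ] E) {v : ℝ → V} (hv : MemLp v 2 ((volume : Measure ℝ).restrict (Ioc a b))) :
    ⟪M (∫ r in a..b, L r (v r)), ∫ r in a..b, L r (v r)⟫_ℝ ≤
      √(∫ r in a..b, ∫ r' in a..b, ‖(L r).adjoint ∘L M ∘L L r'‖ ^ 2)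
        * ∫ r in a..b, ‖v r‖ ^ 2 := by
  set K : ℝ → ℝ → V →L[ℝ] V := fun r r' => (L r).adjoint ∘L M ∘L L r' with hK
  set N : ℝ := ∫ r in a..b, ‖v r‖ ^ 2 with hN
  have hN0 : 0 ≤ N := intervalIntegral.integral_nonneg hab fun r _ => by positivity
  have hadj : Continuous fun r => (L r).adjoint :=
    (ContinuousLinearMap.adjoint (𝕜 := ℝ) (E := V) (F := E)).continuous.comp hL
  have hKc : Continuous (Function.uncurry K) :=
    (hadj.comp continuous_fst).clm_comp (continuous_const.clm_comp (hL.comp continuous_snd))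
  set k : ℝ → ℝ := fun r => √(∫ r' in a..b, ‖K r r'‖ ^ 2) with hk
  have hkc : Continuous k := by
    refine Continuous.sqrt ?_
    exact intervalIntegral.continuous_parametric_intervalIntegral_of_continuous'
      (f := fun r r' => ‖K r r'‖ ^ 2) ((continuous_pow 2).comp hKc.norm) a b
  have hint := intervalIntegrable_clm_apply_of_memLp hL hab hv
  have hvn : IntervalIntegrable (fun r => ‖v r‖) volume a b := by
    rw [intervalIntegrable_iff_integrableOn_Ioc_of_le hab]
    exact (hv.integrable one_le_two).norm
  set p : E := ∫ r in a..b, L r (v r) with hp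
  -- First Cauchy–Schwarz, in `r'`: the vector is the integral of `K r r' (v r')`, and `k r` is the
  -- `L²` norm of the row `K r`.
  have hcol : ∀ r, ‖(L r).adjoint (M p)‖ ≤ k r * √N := by
    intro r
    have hcomp : (L r).adjoint (M p) = ∫ r' in a..b, K r r' (v r') := by
      exact (ContinuousLinearMap.intervalIntegral_comp_comm ((L r).adjoint ∘L M) hint).symm
    rw [hcomp]
    refine (intervalIntegral.norm_integral_le_integral_norm hab).trans ?_
    have hKr : Continuous (K r) :=
      continuous_const.clm_comp (continuous_const.clm_comp hL)
    refine le_trans ?_ (intervalIntegral_mul_norm_le hab hKr.norm (fun _ => norm_nonneg _) hv)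
    refine intervalIntegral.integral_mono_on hab (intervalIntegrable_clm_apply_of_memLp hKr hab hv).norm
      (hvn.continuousOn_mul hKr.norm.continuousOn) fun r' _ => (K r r').le_opNorm _
  have hrow : ⟪M p, p⟫_ℝ = ∫ r in a..b, ⟪(L r).adjoint (M p), v r⟫_ℝ := by
    conv_lhs => rw [hp]
    rw [← innerSL_apply_apply ℝ, ← ContinuousLinearMap.intervalIntegral_comp_comm _ hint]
    refine intervalIntegral.integral_congr fun r _ => ?_
    simp only [innerSL_apply_apply, ContinuousLinearMap.adjoint_inner_left, ← hp]
  have hi : IntervalIntegrable (fun r => ⟪(L r).adjoint (M p), v r⟫_ℝ) volume a b :=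
    intervalIntegrable_clm_apply_of_memLp (L := fun r => innerSL ℝ ((L r).adjoint (M p)))
      ((innerSL ℝ).continuous.comp (hadj.clm_apply continuous_const)) hab hv
  rw [hrow]
  -- Second Cauchy–Schwarz, in `r`; the two factors `√N` combine to `N`.
  calc ∫ r in a..b, ⟪(L r).adjoint (M p), v r⟫_ℝ
      ≤ ∫ r in a..b, √N * (k r * ‖v r‖) := by
        refine intervalIntegral.integral_mono_on hab hi
          ((hvn.continuousOn_mul hkc.continuousOn).const_mul _) fun r _ => ?_
        refine (real_inner_le_norm _ _).trans ?_
        refine (mul_le_mul_of_nonneg_right (hcol r) (norm_nonneg _)).trans (le_of_eq ?_)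
        ring
    _ = √N * ∫ r in a..b, k r * ‖v r‖ := intervalIntegral.integral_const_mul _ _
    _ ≤ √N * (√(∫ r in a..b, k r ^ 2) * √N) := by
        refine mul_le_mul_of_nonneg_left ?_ (Real.sqrt_nonneg _)
        exact intervalIntegral_mul_norm_le hab hkc (fun _ => Real.sqrt_nonneg _) hv
    _ = √(∫ r in a..b, ∫ r' in a..b, ‖K r r'‖ ^ 2) * N := by
        have : ∀ r, k r ^ 2 = ∫ r' in a..b, ‖K r r'‖ ^ 2 := fun r =>
          Real.sq_sqrt (intervalIntegral.integral_nonneg hab fun _ _ => by positivity)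
        simp only [this]
        nth_rewrite 3 [← Real.mul_self_sqrt hN0]
        ring

end HilbertSchmidt

/-! ### Completion of the square. -/

section CompletionOfSquares

variable {V E : Type*} [NormedAddCommGroup V] [InnerProductSpace ℝ V] [FiniteDimensional ℝ V]
  [NormedAddCommGroup E] [InnerProductSpace ℝ E] [FiniteDimensional ℝ E]

/-- Coercivity gives injectivity, which suffices in finite dimension. This ensures that `R.inverse`
is a true inverse and not the default value zero. -/
theorem isInvertible_of_le {ρ : ℝ} (hρ : 0 < ρ) {R : V →L[ℝ] V}
    (hR : ρ • (1 : V →L[ℝ] V) ≤ R) : R.IsInvertible := by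
  have hpos : ∀ x, ρ * ‖x‖ ^ 2 ≤ ⟪R x, x⟫_ℝ := by
    intro x
    have := ((ContinuousLinearMap.le_def _ _).1 hR).inner_nonneg_left x
    simp only [sub_apply, smul_apply, one_apply_eq_self, inner_sub_left,
      real_inner_smul_left, real_inner_self_eq_norm_sq] at this
    linarith
  have hinj : Function.Injective (R : V →ₗ[ℝ] V) := by
    rw [injective_iff_map_eq_zero]
    intro x hx
    have h1 := hpos x
    rw [show R x = 0 from hx, inner_zero_left] at h1
    have h2 : ‖x‖ ^ 2 ≤ 0 := by nlinarith [sq_nonneg ‖x‖]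
    exact norm_eq_zero.1 (pow_eq_zero_iff two_ne_zero |>.1 (le_antisymm h2 (sq_nonneg _)))
  exact ⟨(LinearEquiv.ofInjectiveEndo _ hinj).toContinuousLinearEquiv, by ext; rfl⟩

/-- Completion of the square in the quadratic form with the blocks `A₁`, `C`, `R`. -/
theorem inner_add_inner_add_inner_ge {ρ α : ℝ} (hρ : 0 < ρ) (hα : 0 < α) {R : V →L[ℝ] V}
    (hR : ρ • (1 : V →L[ℝ] V) ≤ R) (hRs : R.adjoint = R) {A₁ Q : E →L[ℝ] E} {C : E →L[ℝ] V}
    (h : 0 ≤ A₁ + Q - α⁻¹ • (C.adjoint ∘L R.inverse ∘L C)) (x : E) (v : V) :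
    (1 - α) * ⟪R v, v⟫_ℝ - ⟪Q x, x⟫_ℝ ≤ ⟪R v, v⟫_ℝ + ⟪A₁ x, x⟫_ℝ + 2 * ⟪C x, v⟫_ℝ := by
  have h1 := ((ContinuousLinearMap.nonneg_iff_isPositive _).1 h).inner_nonneg_left x
  simp only [sub_apply, add_apply, smul_apply, ContinuousLinearMap.comp_apply, inner_sub_left,
    inner_add_left, real_inner_smul_left, ContinuousLinearMap.adjoint_inner_left] at h1
  set w := R.inverse (C x) with hw
  have hRw : R w = C x := (isInvertible_of_le hρ hR).self_apply_inverse (C x)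
  have hRpos : ∀ z, 0 ≤ ⟪R z, z⟫_ℝ := by
    intro z
    have := ((ContinuousLinearMap.le_def _ _).1 hR).inner_nonneg_left z
    simp only [sub_apply, smul_apply, one_apply_eq_self, inner_sub_left,
      real_inner_smul_left, real_inner_self_eq_norm_sq] at this
    have h2 : 0 ≤ ρ * ‖z‖ ^ 2 := by positivity
    linarith
  -- With `w = R⁻¹Cx`, expanding this square gives `α⟨Rv,v⟩ + 2⟨Cx,v⟩ + α⁻¹⟨R⁻¹Cx,Cx⟩`, and `h`
  -- bounds the last term by `⟨(A₁+Q)x,x⟩`.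
  have h2 := mul_nonneg hα.le (hRpos (v + α⁻¹ • w))
  have h3 : ⟪R v, w⟫_ℝ = ⟪C x, v⟫_ℝ := by
    rw [← hRs, ContinuousLinearMap.adjoint_inner_left, hRw, real_inner_comm]
  have h4 : α * ⟪R (v + α⁻¹ • w), v + α⁻¹ • w⟫_ℝ
      = α * ⟪R v, v⟫_ℝ + 2 * ⟪C x, v⟫_ℝ + α⁻¹ * ⟪w, C x⟫_ℝ := by
    rw [map_add, map_smul, hRw, inner_add_left, inner_add_right, inner_add_right,
      real_inner_smul_left, real_inner_smul_left, real_inner_smul_right, real_inner_smul_right, h3,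
      real_inner_comm (C x) w]
    field_simp
    ring
  have h5 := real_inner_comm w (C x)
  linarith

end CompletionOfSquares

/-! ### The lower bound for the second derivative. -/

namespace AQProblem

section UniformPositivity

variable {n m : ℕ} {P : AQProblem n m} (hT : 0 < P.T) (h1 : P.H1) (h2 : P.H2) (h3 : P.H3) {t : ℝ}
  (ht : t ∈ Icc 0 P.T) {x : RVec n} {u : ControlSpace m t P.T} {X Y : ℝ → RVec n}
  (hX : P.IsState t x u X) (hY : P.IsAdjointState t u X Y) {Φ : ℝ → ℝ → RMat n n}
  (hΦ : P.IsFundamentalMatrix t (fun s => P.bA s (X s) (u s)) Φ)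

include hT h1 h3 ht hX hΦ

/-- The factorization of `Φ` makes the kernel `Φ(τ,r)B(r,X(r))` continuous in `r`, so the
Hilbert–Schmidt bound applies on `[t, τ]`. -/
theorem inner_linResponse_le (M : RMat n n) (v : ControlSpace m t P.T) {τ : ℝ}
    (hτ : τ ∈ Icc t P.T) :
    ⟪M (P.linResponse t X Φ v τ), P.linResponse t X Φ v τ⟫_ℝ ≤
      P.kernelNorm t X Φ M τ * ∫ r in t..τ, ‖v r‖ ^ 2 := by
  have hL := lipschitzCoeffs hT h1 h3 ht
  have hXZ : ∀ s (hs : s ∈ Icc t P.T), X s = stateMap ht.2 hL x u ⟨s, hs⟩ :=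
    fun s hs => hX.eq_stateMap hT h3 ht hL hs
  obtain ⟨hM, hM2⟩ := intervalIntegrable_bA hT h3 ht hXZ u
  obtain ⟨Ψ, W, -, hW, hfac, -⟩ := exists_factor_fundamental ht.2 hM hM2 hΦ
  -- The extension of `B` along `X` beyond `[t, T]` by its end values makes `L` continuous on the
  -- whole line without changing the integrals.
  set L : ℝ → RMat n m := fun r =>
    Ψ τ ∘L W r ∘L IccExtend ht.2 (superpose (coeffB hT h3 ht).f₀ (stateMap ht.2 hL x u)) r with hLdef
  have hLc : Continuous L :=
    continuous_const.clm_comp (hW.clm_comp (continuous_iccExtend ht.2 _))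
  have hLeq : ∀ r ∈ Icc t τ, Φ τ r ∘L P.B r (X r) = L r := by
    intro r hr
    have hr' : r ∈ Icc t P.T := ⟨hr.1, hr.2.trans hτ.2⟩
    simp only [hLdef, IccExtend_of_mem ht.2 _ hr', hfac r hr' τ ⟨hr.2, hτ.2⟩, hXZ r hr']
    rfl
  have hlin : P.linResponse t X Φ v τ = ∫ r in t..τ, L r (v r) := by
    refine intervalIntegral.integral_congr fun r hr => ?_
    rw [uIcc_of_le hτ.1] at hr
    simp only [← hLeq r hr]
    rfl
  have hker : P.kernelNorm t X Φ M τ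
      = √(∫ r in t..τ, ∫ r' in t..τ, ‖(L r).adjoint ∘L M ∘L L r'‖ ^ 2) := by
    refine congrArg Real.sqrt (intervalIntegral.integral_congr fun r hr => ?_)
    refine intervalIntegral.integral_congr fun r' hr' => ?_
    rw [uIcc_of_le hτ.1] at hr hr'
    simp only [← hLeq r hr, ← hLeq r' hr', ContinuousLinearMap.adjoint_comp]
    rfl
  rw [hlin, hker]
  exact inner_integral_le_hilbertSchmidt hLc hτ.1 M
    ((Lp.memLp v).mono_measure (Measure.restrict_mono (Ioc_subset_Ioc_right hτ.2) le_rfl))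

include h2 hY

/-- The quadratic form of the second derivative is bounded from below. -/
theorem second_derivative_J_ge {Gbar : RMat n n} {Qbar : ℝ → RMat n n} {α δ : ℝ} (hα : 0 < α)
    (hG : 0 ≤ hessian P.G (X P.T) + Gbar)
    (hA₁ : ∀ᵐ s ∂(volume.restrict (Ioc t P.T)),
      0 ≤ P.bA₁ s (X s) (Y s) (u s) + Qbar s
        - α⁻¹ • ((P.bC s (X s) (Y s) (u s)).adjoint ∘L (P.R s (X s)).inverse ∘L
            P.bC s (X s) (Y s) (u s)))
    (hQ : IntervalIntegrable (fun τ => P.kernelNorm t X Φ (Qbar τ) τ) volume t P.T)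
    (hδ : ∀ s ∈ Icc t P.T, δ • (1 : RMat m m) ≤
      (1 - α) • P.R s (X s) - (P.GHat t X Φ Gbar + P.QHat t X Φ Qbar s) • (1 : RMat m m))
    (v : ControlSpace m t P.T) :
    δ * ∫ s in t..P.T, ‖v s‖ ^ 2 ≤ fderiv ℝ (fderiv ℝ (P.J t x)) u v v := by
  obtain ⟨iR, iA, iC, heq⟩ := second_derivative_J hT h1 h2 h3 ht hX hY hΦ v
  have iv := intervalIntegrable_norm_sq ht.2 v
  have hT' : P.T ∈ Icc t P.T := right_mem_Icc.2 ht.2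
  set k : ℝ → ℝ := fun τ => P.kernelNorm t X Φ (Qbar τ) τ with hk
  set N : ℝ → ℝ := fun s => ∫ r in t..s, ‖v r‖ ^ 2 with hN
  have hNeq : ∀ s ∈ Icc t P.T, N s = N t + ∫ r in t..s, ‖v r‖ ^ 2 := fun s _ => by simp [hN]
  -- `Q̂` is absolutely continuous with derivative `-k`, and vanishes at `T`. As `N` vanishes at
  -- `t`, no boundary term arises below.
  have hQeq : ∀ s ∈ Icc t P.T, P.QHat t X Φ Qbar s = P.QHat t X Φ Qbar t + ∫ r in t..s, -k r := by
    intro s hs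
    rw [intervalIntegral.integral_neg, QHat, QHat, ← intervalIntegral.integral_add_adjacent_intervals
      (intervalIntegrable_mono_Icc hQ le_rfl hs.1 hs.2)
      (intervalIntegrable_mono_Icc hQ hs.1 hs.2 le_rfl)]
    ring
  have hNc := continuousOn_of_eq_add_integral ht.2 iv hNeq
  have hQc := continuousOn_of_eq_add_integral ht.2 hQ.neg hQeq
  have ikN : IntervalIntegrable (fun s => k s * N s) volume t P.T := hQ.mul_continuousOn (by
    rwa [uIcc_of_le ht.2])
  have iQv : IntervalIntegrable (fun s => P.QHat t X Φ Qbar s * ‖v s‖ ^ 2) volume t P.T :=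
    iv.continuousOn_mul (by rwa [uIcc_of_le ht.2])
  -- integration by parts
  have hparts : ∫ s in t..P.T, k s * N s = ∫ s in t..P.T, P.QHat t X Φ Qbar s * ‖v s‖ ^ 2 := by
    have h := bilin_eq_add_integral (f := P.QHat t X Φ Qbar) (g := N) (ContinuousLinearMap.mul ℝ ℝ)
      ht.2 hQ.neg iv hQeq hNeq
    have hNt : N t = 0 := by simp [hN]
    have hQT : P.QHat t X Φ Qbar P.T = 0 := by simp [QHat]
    have h0 : ∀ s, (ContinuousLinearMap.mul ℝ ℝ) (-k s) (N s)
        + (ContinuousLinearMap.mul ℝ ℝ) (P.QHat t X Φ Qbar s) (‖v s‖ ^ 2)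
        = P.QHat t X Φ Qbar s * ‖v s‖ ^ 2 - k s * N s := by
      intro s
      simp only [ContinuousLinearMap.mul_apply']
      ring
    simp only [Pi.neg_apply, h0, hNt, hQT, map_zero, zero_apply, zero_add] at h
    rw [intervalIntegral.integral_sub iQv ikN] at h
    linarith
  -- the terminal term
  have hterm : -(P.GHat t X Φ Gbar * N P.T) ≤
      ⟪hessian P.G (X P.T) (P.linResponse t X Φ v P.T), P.linResponse t X Φ v P.T⟫_ℝ := by
    have e1 := ((ContinuousLinearMap.nonneg_iff_isPositive _).1 hG).inner_nonneg_left
      (P.linResponse t X Φ v P.T)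
    rw [add_apply, inner_add_left] at e1
    have e2 := inner_linResponse_le hT h1 h3 ht hX hΦ Gbar v hT'
    have e3 : P.GHat t X Φ Gbar = P.kernelNorm t X Φ Gbar P.T := rfl
    rw [e3]
    linarith
  -- the running term
  obtain ⟨_, _, _, _, _, _, _, _, _, _, ρ₀, hρ₀, ρ, _, hρ, _, hb⟩ := h2.bounds
  have hpt : ∀ᵐ s ∂(volume.restrict (Ioc t P.T)),
      (1 - α) * ⟪P.R s (X s) (v s), v s⟫_ℝ - k s * N s ≤
        ⟪P.R s (X s) (v s), v s⟫_ℝ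
        + ⟪P.bA₁ s (X s) (Y s) (u s) (P.linResponse t X Φ v s), P.linResponse t X Φ v s⟫_ℝ
        + 2 * ⟪P.bC s (X s) (Y s) (u s) (P.linResponse t X Φ v s), v s⟫_ℝ := by
    filter_upwards [hA₁, ae_restrict_mem measurableSet_Ioc] with s hs hmem
    have hmem' := Ioc_subset_Icc_self hmem
    have h0 : s ∈ Icc 0 P.T := ⟨ht.1.trans hmem'.1, hmem'.2⟩
    have e1 := inner_add_inner_add_inner_ge (hρ₀.trans_le (hρ (X s))) hα (hb s h0 (X s)).1
      (h2.symmetric_R s h0 (X s)) hs (P.linResponse t X Φ v s) (v s)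
    have e2 := inner_linResponse_le hT h1 h3 ht hX hΦ (Qbar s) v hmem'
    change _ ≤ k s * N s at e2
    linarith
  have hrun := intervalIntegral.integral_mono_ae_restrict ht.2 ((iR.const_mul (1 - α)).sub ikN)
    ((iR.add iA).add (iC.const_mul 2)) 
      ((Measure.restrict_congr_set (μ := volume) Ioc_ae_eq_Icc).symm.le.absolutelyContinuous hpt)
  -- The assumption on `R` is tested on `v s` and integrated. Its `Ĝ` part pays for the terminal
  -- term, and its `Q̂` part for the running loss `∫ kN`.
  have hlow : ∫ s in t..P.T, δ * ‖v s‖ ^ 2 ≤ ∫ s in t..P.T,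
      ((1 - α) * ⟪P.R s (X s) (v s), v s⟫_ℝ
        - (P.GHat t X Φ Gbar * ‖v s‖ ^ 2 + P.QHat t X Φ Qbar s * ‖v s‖ ^ 2)) := by
    refine intervalIntegral.integral_mono_on ht.2 (iv.const_mul δ)
      ((iR.const_mul _).sub ((iv.const_mul _).add iQv)) fun s hs => ?_
    have e := ((ContinuousLinearMap.le_def _ _).1 (hδ s hs)).inner_nonneg_left (v s)
    simp only [sub_apply, smul_apply, one_apply_eq_self, inner_sub_left, real_inner_smul_left,
      real_inner_self_eq_norm_sq] at e
    linarith
  rw [intervalIntegral.integral_sub (iR.const_mul _) ((iv.const_mul _).add iQv),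
    intervalIntegral.integral_add (iv.const_mul _) iQv] at hlow
  rw [intervalIntegral.integral_sub (iR.const_mul _) ikN,
    intervalIntegral.integral_add (iR.add iA) (iC.const_mul 2),
    intervalIntegral.integral_add iR iA, hparts] at hrun
  simp only [intervalIntegral.integral_const_mul] at hlow hrun
  change _ ≤ _ - (P.GHat t X Φ Gbar * N P.T + _) at hlow
  linarith

end UniformPositivity

end AQProblem

end

/-! ### Assembly in the Hilbert space of controls. -/

theorem proposition5p2 {n m : ℕ} (P : AQProblem n m) (hT : 0 < P.T)
    (h1 : P.H1) (h2 : P.H2) (h3 : P.H3)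
    (t : ℝ) (ht : t ∈ Set.Icc 0 P.T) (x : RVec n) (u : ControlSpace m t P.T)
    (X Y : ℝ → RVec n) (hX : P.IsState t x u X) (hY : P.IsAdjointState t u X Y)
    (Φ : ℝ → ℝ → RMat n n)
    (hΦ : P.IsFundamentalMatrix t (fun s => P.bA s (X s) (u s)) Φ) :
    -- the second derivative exists
    (∀ w, DifferentiableAt ℝ (P.J t x) w) ∧ DifferentiableAt ℝ (P.DuJ t x) u ∧
    -- the explicit expression of its quadratic form (all integrals converge)
    (∀ v : ControlSpace m t P.T,
      IntervalIntegrable (fun s => ⟪P.R s (X s) (v s), v s⟫_ℝ) volume t P.T ∧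
      IntervalIntegrable (fun s => ⟪P.bA₁ s (X s) (Y s) (u s) (P.linResponse t X Φ v s),
        P.linResponse t X Φ v s⟫_ℝ) volume t P.T ∧
      IntervalIntegrable (fun s => ⟪P.bC s (X s) (Y s) (u s) (P.linResponse t X Φ v s), v s⟫_ℝ)
        volume t P.T ∧
      ∫ s in t..P.T, ⟪P.DuuJ t x u v s, v s⟫_ℝ =
        (∫ s in t..P.T, ⟪P.R s (X s) (v s), v s⟫_ℝ)
        + ⟪hessian P.G (X P.T) (P.linResponse t X Φ v P.T), P.linResponse t X Φ v P.T⟫_ℝ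
        + (∫ s in t..P.T, ⟪P.bA₁ s (X s) (Y s) (u s) (P.linResponse t X Φ v s),
            P.linResponse t X Φ v s⟫_ℝ)
        + 2 * ∫ s in t..P.T, ⟪P.bC s (X s) (Y s) (u s) (P.linResponse t X Φ v s), v s⟫_ℝ) ∧
    -- the sufficient condition for uniform positivity
    (∀ (Gbar : RMat n n) (Qbar : ℝ → RMat n n) (α δ : ℝ),
      0 ≤ Gbar → (∀ s ∈ Set.Icc 0 P.T, 0 ≤ Qbar s) → α ∈ Set.Ioo (0 : ℝ) 1 → 0 < δ →
      0 ≤ hessian P.G (X P.T) + Gbar →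
      (∀ᵐ s ∂(volume.restrict (Set.Ioc t P.T)),
        0 ≤ P.bA₁ s (X s) (Y s) (u s) + Qbar s
          - α⁻¹ • ((P.bC s (X s) (Y s) (u s)).adjoint ∘L (P.R s (X s)).inverse ∘L
              P.bC s (X s) (Y s) (u s))) →
      -- the integral that defines `QHat` converges
      IntervalIntegrable (fun τ => P.kernelNorm t X Φ (Qbar τ) τ) volume t P.T →
      (∀ s ∈ Set.Icc t P.T,
        δ • (1 : RMat m m) ≤
          (1 - α) • P.R s (X s) - (P.GHat t X Φ Gbar + P.QHat t X Φ Qbar s) • (1 : RMat m m)) →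
      δ • (1 : ControlSpace m t P.T →L[ℝ] ControlSpace m t P.T) ≤ P.DuuJ t x u) := by
  have hJ : ContDiff ℝ 2 (P.J t x) := AQProblem.contDiff_J hT h1 h3 ht x
  have hpair : ∀ v w : ControlSpace m t P.T,
      ⟪v, w⟫_ℝ = ∫ s in t..P.T, ⟪v s, w s⟫_ℝ := fun v w => by
    rw [L2.inner_def, intervalIntegral.integral_of_le ht.2]
  have hquad : ∀ v : ControlSpace m t P.T,
      ⟪P.DuuJ t x u v, v⟫_ℝ = fderiv ℝ (fderiv ℝ (P.J t x)) u v v :=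
    fun v => inner_fderiv_gradient hJ u v v
  refine ⟨fun w => hJ.differentiable two_ne_zero w, differentiable_gradient hJ u, fun v => ?_,
    fun Gbar Qbar α δ _ _ hα _ hG hA₁ hQ hδ => ?_⟩
  · obtain ⟨iR, iA, iC, heq⟩ := AQProblem.second_derivative_J hT h1 h2 h3 ht hX hY hΦ v
    exact ⟨iR, iA, iC, by rw [← hpair, hquad, heq]⟩
  · rw [ContinuousLinearMap.le_def, ContinuousLinearMap.isPositive_iff]
    -- The operator order requires symmetry of the difference as well as nonnegativity of its
    -- quadratic form.
    refine ⟨fun v w => ?_, fun v => ?_⟩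
    · have h := isSymmetric_fderiv_gradient hJ u v w
      change ⟪P.DuuJ t x u v, w⟫_ℝ = ⟪v, P.DuuJ t x u w⟫_ℝ at h
      simp only [ContinuousLinearMap.coe_coe, sub_apply, smul_apply, one_apply_eq_self,
        inner_sub_left, inner_sub_right, real_inner_smul_left, real_inner_smul_right, h]
    · have h := AQProblem.second_derivative_J_ge hT h1 h2 h3 ht hX hY hΦ hα.1 hG hA₁ hQ hδ v
      have hn : ∫ s in t..P.T, ‖v s‖ ^ 2 = ⟪v, v⟫_ℝ := by
        simp only [hpair, real_inner_self_eq_norm_sq]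
      rw [hn, ← hquad] at h
      simp only [sub_apply, smul_apply, one_apply_eq_self, inner_sub_left, real_inner_smul_left]
      linarith
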